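/- **Conventions.** The *length* of a finite poset is the largest $n$ such that it contains a chain of $n+1$ elements; the *height* of an element $x$ of a finite lattice $L$ is the length of $\{u\in L:u\le x\}$. A finite lattice is *slim* if the set $J(L)$ of its nonzero join-irreducible elements is the union of two chains. A *slim rectangular lattice* is a finite slim semimodular lattice $L$ in which exactly two elements are both (nonzero) join-irreducible and (non-unit) meet-irreducible, and these two elements are complementary. A *4-cell* of $L$ is a cover-preserving 4-element Boolean sublattice $H=\{0_H,a,b,1_H\}$ with $a\wedge b=0_H$ and $a\vee b=1_H$; it is *distributive* if the principal ideal $\{u\in L:u\le 1_H\}$ is a distributive lattice. **Multifork extension.** Let $H=\{0_H,a,b,1_H\}$ be a 4-cell of $L$ and $k\ge 1$ an integer. For edges (prime intervals) of $L$ write $[u,w]\to[x,z]$ if $\{x,u,z,w\}$ is a 4-cell with bottom $x$, top $w$ and $u\ne z$ in the middle. Let $E_a$ be the set of all edges reachable from $[0_H,a]$ by finitely many (possibly zero) steps $\to$, and define $E_b$ from $[0_H,b]$ in the same way. The poset $L'$ obtained from $L$ by *inserting a $k$-fold multifork into $H$* consists of the elements of $L$, new elements $\ell_{e,i}$ for $e\in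 E_a$ and $r_{e,i}$ for $e\in E_b$ ($1\le i\le k$), and new elements $m_{i,j}$ ($1\le i\le j\le k$). Its order is the reflexive transitive closure of the order of $L$ together with the following relations: - $x\le \ell_{e,k}\le\dots\le \ell_{e,1}\le z$ for $e=[x,z]\in E_a$, and $x\le r_{e,1}\le\dots\le r_{e,k}\le z$ for $e=[x,z]\in E_b$; - $\ell_{f,i}\le \ell_{e,i}$ for $e,f\in E_a$ with $e\to f$, and $r_{f,i}\le r_{e,i}$ for $e,f\in E_b$ with $e\to f$; - $\ell_{[0_H,a],j}\le m_{i,j}$, $\ r_{[0_H,b],i}\le m_{i,j}$, and $m_{i,j}\le 1_H$ for $i\le j$; - $m_{i,j}\le m_{i',j'}$ whenever $i\le i'\le j'\le j$. **Lemma.** Let $L$ be a slim rectangular lattice, let $H$ be a distributive 4-cell of $L$, let $k$ be a positive integer, and let $L'$ be obtained from $L$ by inserting a $k$-fold multifork into $H$. Then $L'$ is a slim rectangular lattice, $$|L'|=|L|+k\cdot\operatorname{height}(1_H)+\frac{k(k+1)}2,\qquad\text{and}\qquad \operatorname{length}(L')=\operatorname{length}(L)+k,$$ where the height of $1_H$ is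 taken in $L$. -/

import Mathlib

/-- A lattice is *slim rectangular* if it is finite, slim (its nonzero join-irreducible elements form
the union of two chains), semimodular, it has exactly two *corners* (elements that are both
join-irreducible and meet-irreducible), and the two corners are complementary. -/
structure IsSlimRectangular (L : Type*) [Lattice L] : Prop where
  finite : Finite L
  slim : ∃ C D : Set L, IsChain (· ≤ ·) C ∧ IsChain (· ≤ ·) D ∧ {x : L | SupIrred x} = C ∪ D
  semimodular : IsUpperModularLattice L
  corners : ∃ u v : L, u ≠ v ∧ {x : L | SupIrred x ∧ InfIrred x} = {u, v} ∧
    IsBot (u ⊓ v) ∧ IsTop (u ⊔ v)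

/-- A *4-cell*: a cover-preserving 4-element Boolean sublattice `{bot, left, right, top}`. -/
structure FourCell (L : Type*) [Lattice L] where
  bot : L
  left : L
  right : L
  top : L
  left_inf_right : left ⊓ right = bot
  left_sup_right : left ⊔ right = top
  bot_covBy_left : bot ⋖ left
  bot_covBy_right : bot ⋖ right
  left_covBy_top : left ⋖ top
  right_covBy_top : right ⋖ top

namespace FourCell

/-- A 4-cell is *distributive* if the principal ideal generated by its top is distributive. -/
def IsDistributive {L : Type*} [Lattice L] (H : FourCell L) : Prop :=
  ∀ x y z : L, x ≤ H.top → y ≤ H.top → z ≤ H.top → x ⊓ (y ⊔ z) = (x ⊓ y) ⊔ (x ⊓ z)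

/-- One downward step of a trajectory: `e` is an upper edge of some 4-cell and `f` is the opposite
(lower) edge of the same 4-cell. An edge `x ⋖ z` is represented by the pair `(x, z)`. -/
def StepDown {L : Type*} [Lattice L] (e f : L × L) : Prop :=
  ∃ T : FourCell L, e = (T.left, T.top) ∧ f = (T.bot, T.right)

/-- The edges reached by descending, 4-cell by 4-cell, from the lower left edge of `H`
(this edge included). -/
def leftEdges {L : Type*} [Lattice L] (H : FourCell L) : Set (L × L) :=
  {e | Relation.ReflTransGen StepDown (H.bot, H.left) e}

/-- The edges reached by descending, 4-cell by 4-cell, from the lower right edge of `H`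
(this edge included). -/
def rightEdges {L : Type*} [Lattice L] (H : FourCell L) : Set (L × L) :=
  {e | Relation.ReflTransGen StepDown (H.bot, H.right) e}

/-- The elements of the lattice obtained by inserting a `k`-fold multifork into the 4-cell `H`:

* the old elements;
* `k` new elements on each edge of `H.leftEdges` and on each edge of `H.rightEdges`;
* `k (k + 1) / 2` new elements inside `H`. If `t₀, …, tₖ₋₁` (from left to right) denote the new
  lower covers of `H.top`, then `inner i j` is `tᵢ ∧ ⋯ ∧ tⱼ`; on the lower left edge of `H` the
  element `onLeft _ j` is `H.left ∧ t₀ ∧ ⋯ ∧ tⱼ`, and on the lower right edge of `H` the element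
  `onRight _ i` is `tᵢ ∧ ⋯ ∧ tₖ₋₁ ∧ H.right`. -/
inductive MultiforkExtension {L : Type*} [Lattice L] (H : FourCell L) (k : ℕ)
  | old (x : L)
  | onLeft (e : L × L) (he : e ∈ H.leftEdges) (i : Fin k)
  | onRight (e : L × L) (he : e ∈ H.rightEdges) (i : Fin k)
  | inner (i j : Fin k) (hij : i ≤ j)

namespace MultiforkExtension

/-- The relations that generate the order of the multifork extension. -/
inductive Step {L : Type*} [Lattice L] {H : FourCell L} {k : ℕ} :
    MultiforkExtension H k → MultiforkExtension H k → Prop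
  /-- the old order is kept -/
  | old_old (x y : L) (hxy : x ≤ y) : Step (old x) (old y)
  /-- the new elements on the edge `x ⋖ z` form a chain between `x` and `z` -/
  | old_onLeft (e : L × L) (he : e ∈ H.leftEdges) (i : Fin k) : Step (old e.1) (onLeft e he i)
  | onLeft_old (e : L × L) (he : e ∈ H.leftEdges) (i : Fin k) : Step (onLeft e he i) (old e.2)
  | onLeft_chain (e : L × L) (he : e ∈ H.leftEdges) (i i' : Fin k) (h : i' ≤ i) :
      Step (onLeft e he i) (onLeft e he i')
  | old_onRight (e : L × L) (he : e ∈ H.rightEdges) (i : Fin k) : Step (old e.1) (onRight e he i)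
  | onRight_old (e : L × L) (he : e ∈ H.rightEdges) (i : Fin k) : Step (onRight e he i) (old e.2)
  | onRight_chain (e : L × L) (he : e ∈ H.rightEdges) (i i' : Fin k) (h : i ≤ i') :
      Step (onRight e he i) (onRight e he i')
  /-- on two opposite edges of a 4-cell, the corresponding new elements are connected -/
  | onLeft_cross (e f : L × L) (he : e ∈ H.leftEdges) (hf : f ∈ H.leftEdges)
      (hef : StepDown e f) (i : Fin k) : Step (onLeft f hf i) (onLeft e he i)
  | onRight_cross (e f : L × L) (he : e ∈ H.rightEdges) (hf : f ∈ H.rightEdges)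
      (hef : StepDown e f) (i : Fin k) : Step (onRight f hf i) (onRight e he i)
  /-- the new elements on the two lower edges of `H` are connected to those inside `H` -/
  | onLeft_inner (he : (H.bot, H.left) ∈ H.leftEdges) (i j : Fin k) (hij : i ≤ j) :
      Step (onLeft (H.bot, H.left) he j) (inner i j hij)
  | onRight_inner (he : (H.bot, H.right) ∈ H.rightEdges) (i j : Fin k) (hij : i ≤ j) :
      Step (onRight (H.bot, H.right) he i) (inner i j hij)
  /-- inside `H`, a shorter meet `tᵢ ∧ ⋯ ∧ tⱼ` is larger -/
  | inner_inner (i j i' j' : Fin k) (hij : i ≤ j) (hij' : i' ≤ j') (hi : i ≤ i') (hj : j' ≤ j) :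
      Step (inner i j hij) (inner i' j' hij')
  | inner_old (i j : Fin k) (hij : i ≤ j) : Step (inner i j hij) (old H.top)

end MultiforkExtension

theorem covBy_of_mem_leftEdges {L : Type*} [Lattice L] {H : FourCell L} {e : L × L}
    (he : e ∈ H.leftEdges) : e.1 ⋖ e.2 := by
  rcases Relation.ReflTransGen.cases_tail he with h | ⟨f, -, T, -, h⟩
  · rw [h]; exact H.bot_covBy_left
  · rw [h]; exact T.bot_covBy_right

theorem covBy_of_mem_rightEdges {L : Type*} [Lattice L] {H : FourCell L} {e : L × L}
    (he : e ∈ H.rightEdges) : e.1 ⋖ e.2 := by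
  rcases Relation.ReflTransGen.cases_tail he with h | ⟨f, -, T, -, h⟩
  · rw [h]; exact H.bot_covBy_right
  · rw [h]; exact T.bot_covBy_right

namespace MultiforkExtension

/-- Auxiliary rank, used only to see that the generated relation is antisymmetric. -/
def rank {L : Type*} [Lattice L] {H : FourCell L} {k : ℕ} : MultiforkExtension H k → L ×ₗ ℕ
  | old x => toLex (x, k)
  | onLeft e _ i => toLex (e.2, k - 1 - i)
  | onRight e _ i => toLex (e.2, i)
  | inner i j _ => toLex (H.top, k - 1 - (j - i))

theorem Step.eq_or_rank_lt {L : Type*} [Lattice L] {H : FourCell L} {k : ℕ}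
    {a b : MultiforkExtension H k} (h : Step a b) : a = b ∨ rank a < rank b := by
  induction h with
  | old_old x y hxy =>
    rcases hxy.eq_or_lt with rfl | h
    · exact Or.inl rfl
    · exact Or.inr (Prod.Lex.toLex_lt_toLex.2 (Or.inl h))
  | old_onLeft e he i =>
    exact Or.inr (Prod.Lex.toLex_lt_toLex.2 (Or.inl (covBy_of_mem_leftEdges he).lt))
  | onLeft_old e he i =>
    exact Or.inr (Prod.Lex.toLex_lt_toLex.2 (Or.inr ⟨rfl, by dsimp only; omega⟩))
  | onLeft_chain e he i i' h =>
    rcases h.eq_or_lt with rfl | h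
    · exact Or.inl rfl
    · exact Or.inr (Prod.Lex.toLex_lt_toLex.2 (Or.inr ⟨rfl, by dsimp only; omega⟩))
  | old_onRight e he i =>
    exact Or.inr (Prod.Lex.toLex_lt_toLex.2 (Or.inl (covBy_of_mem_rightEdges he).lt))
  | onRight_old e he i =>
    exact Or.inr (Prod.Lex.toLex_lt_toLex.2 (Or.inr ⟨rfl, by dsimp only; omega⟩))
  | onRight_chain e he i i' h =>
    rcases h.eq_or_lt with rfl | h
    · exact Or.inl rfl
    · exact Or.inr (Prod.Lex.toLex_lt_toLex.2 (Or.inr ⟨rfl, by dsimp only; omega⟩))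
  | onLeft_cross e f he hf hef i =>
    obtain ⟨T, rfl, rfl⟩ := hef
    exact Or.inr (Prod.Lex.toLex_lt_toLex.2 (Or.inl T.right_covBy_top.lt))
  | onRight_cross e f he hf hef i =>
    obtain ⟨T, rfl, rfl⟩ := hef
    exact Or.inr (Prod.Lex.toLex_lt_toLex.2 (Or.inl T.right_covBy_top.lt))
  | onLeft_inner he i j hij =>
    exact Or.inr (Prod.Lex.toLex_lt_toLex.2 (Or.inl H.left_covBy_top.lt))
  | onRight_inner he i j hij =>
    exact Or.inr (Prod.Lex.toLex_lt_toLex.2 (Or.inl H.right_covBy_top.lt))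
  | inner_inner i j i' j' hij hij' hi hj =>
    by_cases h : i = i' ∧ j = j'
    · obtain ⟨rfl, rfl⟩ := h
      exact Or.inl rfl
    · exact Or.inr (Prod.Lex.toLex_lt_toLex.2 (Or.inr ⟨rfl, by dsimp only; omega⟩))
  | inner_old i j hij =>
    exact Or.inr (Prod.Lex.toLex_lt_toLex.2 (Or.inr ⟨rfl, by dsimp only; omega⟩))

theorem eq_or_rank_lt {L : Type*} [Lattice L] {H : FourCell L} {k : ℕ}
    {a b : MultiforkExtension H k} (h : Relation.ReflTransGen Step a b) :
    a = b ∨ rank a < rank b := by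
  induction h with
  | refl => exact Or.inl rfl
  | tail _ h ih =>
    rcases ih with rfl | ih
    · exact h.eq_or_rank_lt
    · rcases h.eq_or_rank_lt with rfl | h'
      · exact Or.inr ih
      · exact Or.inr (ih.trans h')

/-- The order of the multifork extension: the reflexive transitive closure of `Step`. -/
instance {L : Type*} [Lattice L] {H : FourCell L} {k : ℕ} :
    PartialOrder (MultiforkExtension H k) where
  le := Relation.ReflTransGen Step
  le_refl _ := Relation.ReflTransGen.refl
  le_trans _ _ _ := Relation.ReflTransGen.trans
  le_antisymm a b hab hba := by
    rcases eq_or_rank_lt hab with h | h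
    · exact h
    · rcases eq_or_rank_lt hba with h' | h'
      · exact h'.symm
      · exact absurd (h.trans h') (lt_irrefl _)

end MultiforkExtension

end FourCell

/-! The proof translates everything into integer points. Let `u`, `v` be the two corners of a slim
rectangular lattice. The ideals below them are chains that contain all join-irreducibles and meet
only in the bottom, so `x` is determined by the positions of `x ⊓ u` and `x ⊓ v` in these chains.
This embeds the lattice into a grid as a meet-closed set containing the top and both lower edges.
Semimodularity becomes a local condition: if `y` is the least element that strictly exceeds `x` in
one coordinate and is not smaller in the other, then `y` covers `x`. Conversely, every poset with
such coordinates is a slim rectangular lattice, so the construction can be checked on coordinates.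

If the ideal of `H.top` is distributive, it is a full grid with columns `0, …, m` and rows `0, …,
n`, and `H` is its top corner cell. The two trajectories descending from `H` are then a strip of `n`
edges between the last two columns and a strip of `m` edges between the last two rows. Inserting the
multifork puts `k` new columns before column `m` and `k` new rows before row `n`, and adds all
points on or below a staircase inside `H`. The order generated by the multifork relations is exactly
the componentwise order (`multifork_le_iff`), and the grid conditions survive
(`IsStaircaseExtension.isGridCoordinates`).

The cardinality follows by counting new points, since `H.top` has height `m + n`. For the length,
semimodularity makes every maximal chain equally long, so one chain suffices: along a lower edge to
the column of `H.top`, up that column to `H.top`, and then further up. The insertion lengthens only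
the first piece, by `k`. -/

/-- `f` and `g` are the coordinates of an embedding of the poset `P` onto a meet-closed subset of
the grid `{0, …, M} × {0, …, N}` that contains the top of the grid and its two lower edges, such
that the closure of a point next to an element of `P` covers this element. -/
structure IsGridCoordinates {P : Type*} [PartialOrder P] (f g : P → ℕ) (M N : ℕ) : Prop where
  pos_fst : 0 < M
  pos_snd : 0 < N
  le_iff : ∀ {x y : P}, x ≤ y ↔ f x ≤ f y ∧ g x ≤ g y
  exists_inf : ∀ x y : P, ∃ z, f z = min (f x) (f y) ∧ g z = min (g x) (g y)
  exists_top : ∃ t, f t = M ∧ g t = N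
  le_fst : ∀ x, f x ≤ M
  le_snd : ∀ x, g x ≤ N
  exists_fst : ∀ i ≤ M, ∃ x, f x = i ∧ g x = 0
  exists_snd : ∀ j ≤ N, ∃ x, f x = 0 ∧ g x = j
  covBy_fst : ∀ {x y : P}, f x < f y → g x ≤ g y →
    (∀ z, f x < f z → g x ≤ g z → y ≤ z) → x ⋖ y
  covBy_snd : ∀ {x y : P}, f x ≤ f y → g x < g y →
    (∀ z, f x ≤ f z → g x < g z → y ≤ z) → x ⋖ y

/-! ### From grid coordinates to slim rectangular lattices -/

namespace IsGridCoordinates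

section Poset

variable {P : Type*} [PartialOrder P] {f g : P → ℕ} {M N : ℕ}

theorem swap (h : IsGridCoordinates f g M N) : IsGridCoordinates g f N M where
  pos_fst := h.pos_snd
  pos_snd := h.pos_fst
  le_iff := h.le_iff.trans and_comm
  exists_inf x y := (h.exists_inf x y).imp fun _ => And.symm
  exists_top := h.exists_top.imp fun _ => And.symm
  le_fst := h.le_snd
  le_snd := h.le_fst
  exists_fst i hi := (h.exists_snd i hi).imp fun _ => And.symm
  exists_snd i hi := (h.exists_fst i hi).imp fun _ => And.symm
  covBy_fst h1 h2 h3 := h.covBy_snd h2 h1 fun z hz hz' => h3 z hz' hz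
  covBy_snd h1 h2 h3 := h.covBy_fst h2 h1 fun z hz hz' => h3 z hz' hz

theorem ext (h : IsGridCoordinates f g M N) {x y : P} (h1 : f x = f y) (h2 : g x = g y) :
    x = y :=
  le_antisymm (h.le_iff.2 ⟨h1.le, h2.le⟩) (h.le_iff.2 ⟨h1.ge, h2.ge⟩)

theorem lt_iff (h : IsGridCoordinates f g M N) {x y : P} :
    x < y ↔ f x ≤ f y ∧ g x ≤ g y ∧ (f x < f y ∨ g x < g y) := by
  rw [lt_iff_le_not_ge, h.le_iff, h.le_iff]
  omega

theorem finite (h : IsGridCoordinates f g M N) : Finite P := by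
  refine Finite.of_injective
    (fun x => ((⟨f x, Nat.lt_succ_of_le (h.le_fst x)⟩ : Fin (M + 1)),
      (⟨g x, Nat.lt_succ_of_le (h.le_snd x)⟩ : Fin (N + 1)))) fun x y hxy => ?_
  simp only [Prod.mk.injEq, Fin.mk.injEq] at hxy
  exact h.ext hxy.1 hxy.2

theorem covBy_of_add_one_fst (h : IsGridCoordinates f g M N) {x y : P} (h1 : f y = f x + 1)
    (h2 : g y = g x) : x ⋖ y := by
  refine ⟨h.lt_iff.2 (by omega), fun z hxz hzy => ?_⟩
  rw [h.lt_iff] at hxz hzy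
  omega

/-- A poset with grid coordinates is a lattice. -/
theorem exists_lattice (h : IsGridCoordinates f g M N) :
    ∃ inst : Lattice P, inst.toSemilatticeSup.toPartialOrder = (inferInstance : PartialOrder P) := by
  have hfin := h.finite
  choose inf hf hg using h.exists_inf
  have hsup : ∀ x y : P, ∃ z, IsLeast {z | x ≤ z ∧ y ≤ z} z := by
    intro x y
    obtain ⟨t, ht⟩ := h.exists_top
    obtain ⟨z, hz⟩ := (Set.toFinite {z | x ≤ z ∧ y ≤ z}).exists_minimal
      ⟨t, h.le_iff.2 ⟨ht.1 ▸ h.le_fst x, ht.2 ▸ h.le_snd x⟩,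
        h.le_iff.2 ⟨ht.1 ▸ h.le_fst y, ht.2 ▸ h.le_snd y⟩⟩
    refine ⟨z, hz.prop, fun w hw => ?_⟩
    have hzw : inf z w ≤ z := h.le_iff.2 (by rw [hf, hg]; omega)
    have hmem : inf z w ∈ {z | x ≤ z ∧ y ≤ z} := by
      have := hz.prop
      simp only [Set.mem_ofPred_eq, h.le_iff, hf, hg] at this hw ⊢
      omega
    refine (hz.le_of_le hmem hzw).trans (h.le_iff.2 ?_)
    rw [hf, hg]; omega
  choose sup hsup using hsup
  refine ⟨{ (inferInstance : PartialOrder P) with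
    sup := sup
    inf := inf
    le_sup_left := fun x y => (hsup x y).1.1
    le_sup_right := fun x y => (hsup x y).1.2
    sup_le := fun x y z hx hy => (hsup x y).2 ⟨hx, hy⟩
    inf_le_left := fun x y => h.le_iff.2 (by rw [hf, hg]; omega)
    inf_le_right := fun x y => h.le_iff.2 (by rw [hf, hg]; omega)
    le_inf := fun x y z hx hy => h.le_iff.2 (by
      rw [h.le_iff] at hx hy
      rw [hf, hg]; omega) }, rfl⟩

end Poset

section Lattice

variable {L : Type*} [Lattice L] {f g : L → ℕ} {M N : ℕ}

theorem fst_inf (h : IsGridCoordinates f g M N) (x y : L) : f (x ⊓ y) = min (f x) (f y) := by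
  obtain ⟨z, hz⟩ := h.exists_inf x y
  have h1 : z ≤ x ⊓ y := le_inf (h.le_iff.2 (by omega)) (h.le_iff.2 (by omega))
  have h2 : x ⊓ y ≤ x := inf_le_left
  have h3 : x ⊓ y ≤ y := inf_le_right
  rw [h.le_iff] at h1 h2 h3
  omega

theorem snd_inf (h : IsGridCoordinates f g M N) (x y : L) : g (x ⊓ y) = min (g x) (g y) :=
  h.swap.fst_inf x y

theorem fst_mono (h : IsGridCoordinates f g M N) {x y : L} (hxy : x ≤ y) : f x ≤ f y :=
  (h.le_iff.1 hxy).1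

theorem snd_mono (h : IsGridCoordinates f g M N) {x y : L} (hxy : x ≤ y) : g x ≤ g y :=
  (h.le_iff.1 hxy).2

/-- The join is the least element beyond `b` in the first coordinate and not below it in the second,
so the covering condition of the grid applies. For such a `z`, the element `a ⊓ z` lies strictly
above `a ⊓ b`, and `a ⊓ b ⋖ a` forces `a ≤ z`. -/
theorem covBy_sup_of_fst_lt (h : IsGridCoordinates f g M N) {a b : L} (hab : a ⊓ b ⋖ a)
    (hlt : f (a ⊓ b) < f a) : b ⋖ a ⊔ b := by
  have hf := h.fst_inf a b
  have hg := h.snd_inf a b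
  have hb : b ≤ a ⊔ b := le_sup_right
  have ha : a ≤ a ⊔ b := le_sup_left
  refine h.covBy_fst ?_ (h.snd_mono hb) fun z hz hz' => sup_le ?_ (h.le_iff.2 ⟨hz.le, hz'⟩)
  · have := h.fst_mono ha
    omega
  · have h1 := h.fst_inf a z
    have h2 := h.snd_inf a z
    by_contra hcon
    refine hab.2 (c := a ⊓ z) (h.lt_iff.2 (by omega)) (inf_lt_left.2 hcon)

theorem isUpperModularLattice (h : IsGridCoordinates f g M N) : IsUpperModularLattice L := by
  refine ⟨fun {a b} hab => ?_⟩
  rcases (h.lt_iff.1 hab.1).2.2 with hlt | hlt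
  · exact h.covBy_sup_of_fst_lt hab hlt
  · exact h.swap.covBy_sup_of_fst_lt hab hlt

/-- Here `c` and `d` are the projections of `x` to the two lower edges of the grid. This confines
the join-irreducibles to these edges. -/
theorem sup_eq (h : IsGridCoordinates f g M N) {x c d : L} (hc : f c = f x) (hc' : g c = 0)
    (hd : f d = 0) (hd' : g d = g x) : c ⊔ d = x := by
  refine le_antisymm (sup_le (h.le_iff.2 (by omega)) (h.le_iff.2 (by omega))) (h.le_iff.2 ?_)
  have h1 := h.fst_mono (le_sup_left : c ≤ c ⊔ d)
  have h2 := h.snd_mono (le_sup_right : d ≤ c ⊔ d)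
  omega

theorem eq_zero_of_supIrred (h : IsGridCoordinates f g M N) {x : L} (hx : SupIrred x) :
    f x = 0 ∨ g x = 0 := by
  obtain ⟨c, hc, hc'⟩ := h.exists_fst (f x) (h.le_fst x)
  obtain ⟨d, hd, hd'⟩ := h.exists_snd (g x) (h.le_snd x)
  rcases hx.2 (h.sup_eq hc hc' hd hd') with rfl | rfl
  · exact Or.inr hc'
  · exact Or.inl hd

theorem le_total_of_snd_eq (h : IsGridCoordinates f g M N) {x y : L} (hxy : g x = g y) :
    x ≤ y ∨ y ≤ x := by
  rw [h.le_iff, h.le_iff]; omega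

theorem supIrred_of_snd_eq_zero (h : IsGridCoordinates f g M N) {x : L} (hx : 0 < f x)
    (hx' : g x = 0) : SupIrred x := by
  refine ⟨fun hmin => ?_, fun {b c} hbc => ?_⟩
  · obtain ⟨z, hz⟩ := h.exists_fst 0 (Nat.zero_le _)
    have := h.fst_mono (hmin (h.le_iff.2 (by omega) : z ≤ x))
    omega
  · have hb := h.snd_mono (hbc ▸ le_sup_left : b ≤ x)
    have hc := h.snd_mono (hbc ▸ le_sup_right : c ≤ x)
    rcases h.le_total_of_snd_eq (x := b) (y := c) (by omega) with hle | hle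
    · exact Or.inr (by rwa [sup_eq_right.2 hle] at hbc)
    · exact Or.inl (by rwa [sup_eq_left.2 hle] at hbc)

theorem infIrred_of_fst_eq (h : IsGridCoordinates f g M N) {x : L} (hx : f x = M)
    (hx' : g x < N) : InfIrred x := by
  refine ⟨fun hmax => ?_, fun {b c} hbc => ?_⟩
  · obtain ⟨z, hz⟩ := h.exists_top
    have := h.snd_mono (hmax (h.le_iff.2 (by omega) : x ≤ z))
    omega
  · have hb := h.fst_mono (hbc ▸ inf_le_left : x ≤ b)
    have hc := h.fst_mono (hbc ▸ inf_le_right : x ≤ c)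
    have hb' := h.le_fst b
    have hc' := h.le_fst c
    rcases h.swap.le_total_of_snd_eq (x := b) (y := c) (by omega) with hle | hle
    · exact Or.inl (by rwa [inf_eq_left.2 hle] at hbc)
    · exact Or.inr (by rwa [inf_eq_right.2 hle] at hbc)

/-- Before the end of the lower edge, `x` is the meet of the next point `c` of the edge and of `d ⊔
x`, where `d` is the atom on the other edge. By semimodularity `d ⊔ x` covers `x`, so it stays in
the column of `x`: otherwise `c` would lie strictly in between. -/
theorem fst_eq_of_infIrred (h : IsGridCoordinates f g M N) {x : L} (hx : InfIrred x)
    (hx' : g x = 0) : f x = M := by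
  by_contra hne
  have hlt : f x < M := lt_of_le_of_ne (h.le_fst x) hne
  have := h.isUpperModularLattice
  obtain ⟨o, ho, ho'⟩ := h.exists_fst 0 (Nat.zero_le _)
  obtain ⟨d, hd, hd'⟩ := h.exists_snd 1 h.pos_snd
  obtain ⟨c, hc, hc'⟩ := h.exists_fst (f x + 1) hlt
  have hdx : d ⊓ x = o := h.ext (by rw [h.fst_inf]; omega) (by rw [h.snd_inf]; omega)
  have hcov : x ⋖ d ⊔ x := by
    refine covBy_sup_of_inf_covBy_left ?_
    rw [hdx]
    exact h.swap.covBy_of_add_one_fst (by omega) (by omega)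
  have h1 := h.le_iff.1 (le_sup_left : d ≤ d ⊔ x)
  have h2 := h.le_iff.1 (le_sup_right : x ≤ d ⊔ x)
  have h3 : f (d ⊔ x) = f x := by
    by_contra hne'
    exact hcov.2 (c := c) (h.lt_iff.2 (by omega)) (h.lt_iff.2 (by omega))
  rcases hx.2 (h.ext (by rw [h.fst_inf]; omega) (by rw [h.snd_inf]; omega) : c ⊓ (d ⊔ x) = x)
    with he | he
  · rw [he] at hc; omega
  · rw [he] at h1; omega

/-- A lattice with grid coordinates is slim rectangular. -/
theorem isSlimRectangular (h : IsGridCoordinates f g M N) : IsSlimRectangular L where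
  finite := h.finite
  slim := by
    refine ⟨{x | SupIrred x ∧ g x = 0}, {x | SupIrred x ∧ f x = 0},
      fun x hx y hy _ => h.le_total_of_snd_eq (hx.2.trans hy.2.symm),
      fun x hx y hy _ => h.swap.le_total_of_snd_eq (hx.2.trans hy.2.symm), ?_⟩
    ext x
    constructor
    · intro hx
      rcases h.eq_zero_of_supIrred hx with h0 | h0
      · exact Or.inr ⟨hx, h0⟩
      · exact Or.inl ⟨hx, h0⟩
    · rintro (hx | hx) <;> exact hx.1
  semimodular := h.isUpperModularLattice
  corners := by
    have hM := h.pos_fst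
    have hN := h.pos_snd
    obtain ⟨u, hu, hu'⟩ := h.exists_fst M le_rfl
    obtain ⟨v, hv, hv'⟩ := h.exists_snd N le_rfl
    refine ⟨u, v, fun huv => ?_, ?_, fun x => h.le_iff.2 ?_, fun x => h.le_iff.2 ?_⟩
    · rw [huv] at hu; omega
    · ext x
      constructor
      · rintro ⟨hx, hx'⟩
        rcases h.eq_zero_of_supIrred hx with h0 | h0
        · exact Or.inr (h.ext (by omega) (by rw [h.swap.fst_eq_of_infIrred hx' h0, hv']))
        · exact Or.inl (h.ext (by rw [h.fst_eq_of_infIrred hx' h0, hu]) (by omega))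
      · rintro (rfl | rfl)
        · exact ⟨h.supIrred_of_snd_eq_zero (by omega) hu', h.infIrred_of_fst_eq hu (by omega)⟩
        · exact ⟨h.swap.supIrred_of_snd_eq_zero (by omega) hv,
            h.swap.infIrred_of_fst_eq hv' (by omega)⟩
    · rw [h.fst_inf, h.snd_inf]; omega
    · have h1 := h.fst_mono (le_sup_left : u ≤ u ⊔ v)
      have h2 := h.snd_mono (le_sup_right : v ≤ u ⊔ v)
      have h3 := h.le_fst x
      have h4 := h.le_snd x
      omega

end Lattice

theorem exists_lattice_isSlimRectangular {P : Type*} [PartialOrder P] {f g : P → ℕ} {M N : ℕ}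
    (h : IsGridCoordinates f g M N) :
    ∃ inst : Lattice P, inst.toSemilatticeSup.toPartialOrder = (inferInstance : PartialOrder P) ∧
      @IsSlimRectangular P inst := by
  obtain ⟨inst, rfl⟩ := h.exists_lattice
  exact ⟨inst, rfl, h.isSlimRectangular⟩

end IsGridCoordinates

/-! ### Grid coordinates on a slim rectangular lattice -/

/-- The number of nonzero elements below `x`. -/
noncomputable def belowCard {L : Type*} [Lattice L] [OrderBot L] (x : L) : ℕ := (Set.Ioc ⊥ x).ncard

theorem belowCard_bot {L : Type*} [Lattice L] [OrderBot L] : belowCard (⊥ : L) = 0 := by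
  simp [belowCard]

section SlimRectangular

variable {L : Type*} [Lattice L] [OrderBot L] [Finite L]

theorem le_of_forall_supIrred {x y : L} (h : ∀ c, SupIrred c → c ≤ x → c ≤ y) : x ≤ y := by
  obtain ⟨s, hs, hs'⟩ := exists_supIrred_decomposition x
  rw [← hs]
  exact Finset.sup_le fun c hc => h c (hs' hc) (hs ▸ Finset.le_sup (f := id) hc)

/-- The largest element of one of the two chains of join-irreducibles is meet-irreducible. -/
theorem infIrred_of_upperBound_chain {C D : Set L} (hD : IsChain (· ≤ ·) D)
    (hJ : ∀ c, SupIrred c → c ∈ C ∨ c ∈ D) {p : L} (hp : ∀ c ∈ C, c ≤ p) (hmax : ¬ IsMax p) :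
    InfIrred p := by
  -- All of `C` lies below `p`, so elements above `p` differ only in the members of the chain `D`
  -- below them, and are comparable.
  have htot : ∀ b c, p ≤ b → p ≤ c → b ≤ c ∨ c ≤ b := by
    intro b c hb hc
    by_contra! hcon
    have h1 : ∃ j ∈ D, j ≤ b ∧ ¬ j ≤ c := by
      by_contra! h
      exact hcon.1 (le_of_forall_supIrred fun j hj hjb =>
        (hJ j hj).elim (fun hjC => (hp j hjC).trans hc) fun hjD => h j hjD hjb)
    have h2 : ∃ j ∈ D, j ≤ c ∧ ¬ j ≤ b := by
      by_contra! h
      exact hcon.2 (le_of_forall_supIrred fun j hj hjb =>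
        (hJ j hj).elim (fun hjC => (hp j hjC).trans hb) fun hjD => h j hjD hjb)
    obtain ⟨i, hi, hib, hic⟩ := h1
    obtain ⟨j, hj, hjc, hjb⟩ := h2
    rcases hD.total hi hj with hij | hij
    · exact hic (hij.trans hjc)
    · exact hjb (hij.trans hib)
  refine ⟨hmax, fun {b c} hbc => ?_⟩
  rcases htot b c (hbc ▸ inf_le_left) (hbc ▸ inf_le_right) with hle | hle
  · exact Or.inl (by rwa [inf_eq_left.2 hle] at hbc)
  · exact Or.inr (by rwa [inf_eq_right.2 hle] at hbc)

/-- The principal ideal of a corner is a chain. -/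
theorem isChain_Iic_of_chains {C D : Set L} (hC : IsChain (· ≤ ·) C)
    (hJ : ∀ c, SupIrred c → c ∈ C ∨ c ∈ D) {u v : L} (hD : ∀ d ∈ D, d ≤ v) (huv : u ⊓ v = ⊥) :
    IsChain (· ≤ ·) (Set.Iic u) := by
  -- A member of `D` below `u` would be below `u ⊓ v = ⊥`.
  have hmem : ∀ c, SupIrred c → c ≤ u → c ∈ C := fun c hc hcu =>
    (hJ c hc).resolve_right fun hcD =>
      hc.1 (by rw [isMin_iff_eq_bot, ← le_bot_iff, ← huv]; exact le_inf hcu (hD c hcD))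
  intro x hx y hy _
  change x ≤ y ∨ y ≤ x
  by_contra! hcon
  have h1 : ∃ c ∈ C, c ≤ x ∧ ¬ c ≤ y := by
    by_contra! h
    exact hcon.1 (le_of_forall_supIrred fun c hc hcx => h c (hmem c hc (hcx.trans hx)) hcx)
  have h2 : ∃ c ∈ C, c ≤ y ∧ ¬ c ≤ x := by
    by_contra! h
    exact hcon.2 (le_of_forall_supIrred fun c hc hcy => h c (hmem c hc (hcy.trans hy)) hcy)
  obtain ⟨i, hi, hix, hiy⟩ := h1
  obtain ⟨j, hj, hjy, hjx⟩ := h2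
  rcases hC.total hi hj with hij | hij
  · exact hiy (hij.trans hjy)
  · exact hjx (hij.trans hix)

/-- The upper bounds of the two chains of join-irreducibles of a slim rectangular lattice are its
corners. -/
theorem supIrred_le_corners {C D : Set L} (hC : IsChain (· ≤ ·) C) (hD : IsChain (· ≤ ·) D)
    (hJ : {x : L | SupIrred x} = C ∪ D) {u v : L} (huC : u ∈ C) (hvD : v ∈ D)
    (hcor : {x : L | SupIrred x ∧ InfIrred x} = {u, v}) (hbot : u ⊓ v = ⊥) (htop : IsTop (u ⊔ v)) :
    (∀ c ∈ C, c ≤ u) ∧ ∀ d ∈ D, d ≤ v := by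
  have hu : SupIrred u ∧ InfIrred u := by
    have : u ∈ {x : L | SupIrred x ∧ InfIrred x} := hcor ▸ Or.inl rfl
    exact this
  have hv : SupIrred v ∧ InfIrred v := by
    have : v ∈ {x : L | SupIrred x ∧ InfIrred x} := hcor ▸ Or.inr rfl
    exact this
  have hJC : ∀ c ∈ C, SupIrred c := fun c hc => by
    have : c ∈ {x : L | SupIrred x} := hJ ▸ Or.inl hc
    exact this
  have hJD : ∀ c ∈ D, SupIrred c := fun c hc => by
    have : c ∈ {x : L | SupIrred x} := hJ ▸ Or.inr hc
    exact this
  have hJ' : ∀ c, SupIrred c → c ∈ C ∨ c ∈ D := fun c hc => by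
    have : c ∈ C ∪ D := hJ ▸ hc
    exact this
  have hcor' : ∀ x, SupIrred x → InfIrred x → x = u ∨ x = v := fun x hx hx' => by
    have : x ∈ ({u, v} : Set L) := hcor ▸ (⟨hx, hx'⟩ : SupIrred x ∧ InfIrred x)
    exact this
  have huv : ¬ u ≤ v := fun h =>
    hu.1.1 (by rw [isMin_iff_eq_bot, ← hbot, inf_eq_left.2 h])
  have hvu : ¬ v ≤ u := fun h =>
    hv.1.1 (by rw [isMin_iff_eq_bot, ← hbot, inf_eq_right.2 h])
  obtain ⟨p, hp⟩ := (Set.toFinite C).exists_maximal ⟨u, huC⟩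
  obtain ⟨q, hq⟩ := (Set.toFinite D).exists_maximal ⟨v, hvD⟩
  have hpC : ∀ c ∈ C, c ≤ p := fun c hc => (hC.total hc hp.1).elim id fun h => hp.2 hc h
  have hqD : ∀ c ∈ D, c ≤ q := fun c hc => (hD.total hc hq.1).elim id fun h => hq.2 hc h
  -- A join-irreducible top would equal `u` or `v`, as it is `u ⊔ v`; but these are meet-irreducible
  -- and hence not maximal.
  have hnotmax : ∀ x : L, SupIrred x → ¬ IsMax x := by
    intro x hx hmax
    have he : u ⊔ v = x := (hmax.eq_of_le (htop x)).symm
    rcases hx.2 he with h | h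
    · exact hu.2.1 (h ▸ hmax)
    · exact hv.2.1 (h ▸ hmax)
  have hp' := infIrred_of_upperBound_chain hD hJ' hpC (hnotmax p (hJC p hp.1))
  have hq' := infIrred_of_upperBound_chain hC (fun c hc => (hJ' c hc).symm) hqD
    (hnotmax q (hJD q hq.1))
  constructor
  · rcases hcor' p (hJC p hp.1) hp' with h | h
    · exact h ▸ hpC
    · exact absurd (h ▸ hpC u huC) huv
  · rcases hcor' q (hJD q hq.1) hq' with h | h
    · exact absurd (h ▸ hqD v hvD) hvu
    · exact h ▸ hqD

theorem belowCard_mono {x y : L} (h : x ≤ y) : belowCard x ≤ belowCard y :=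
  Set.ncard_le_ncard (Set.Ioc_subset_Ioc_right h) (Set.toFinite _)

theorem belowCard_strictMono {x y : L} (h : x < y) : belowCard x < belowCard y :=
  Set.ncard_lt_ncard ⟨Set.Ioc_subset_Ioc_right h.le,
    fun hsub => h.not_ge (hsub ⟨bot_le.trans_lt h, le_rfl⟩).2⟩ (Set.toFinite _)

theorem belowCard_le_iff {u x y : L} (hu : IsChain (· ≤ ·) (Set.Iic u)) (hx : x ≤ u)
    (hy : y ≤ u) : belowCard x ≤ belowCard y ↔ x ≤ y := by
  refine ⟨fun h => ?_, belowCard_mono⟩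
  by_contra hcon
  exact (belowCard_strictMono (((hu.total hx hy).resolve_left hcon).lt_of_not_ge hcon)).not_ge h

/-- No value is skipped: in a chain, passing from `x` to a lower cover removes only `x` from the
elements counted. -/
theorem exists_belowCard_eq {u : L} (hu : IsChain (· ≤ ·) (Set.Iic u)) :
    ∀ i ≤ belowCard u, ∃ x ≤ u, belowCard x = i := by
  intro i hi
  induction hi using Nat.decreasingInduction with
  | self => exact ⟨u, le_rfl, rfl⟩
  | of_succ i hi ih =>
    obtain ⟨x, hx, hxi⟩ := ih
    have hx0 : ⊥ < x := bot_lt_iff_ne_bot.2 fun h0 => by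
      rw [h0, belowCard_bot] at hxi; omega
    obtain ⟨y, -, hy⟩ := exists_le_covBy_of_lt hx0
    refine ⟨y, hy.le.trans hx, ?_⟩
    have hset : Set.Ioc ⊥ x = insert x (Set.Ioc ⊥ y) := by
      ext z
      constructor
      · rintro ⟨hz, hzx⟩
        rcases hzx.eq_or_lt with rfl | hzx
        · exact Or.inl rfl
        · refine Or.inr ⟨hz, ?_⟩
          rcases hu.total (hzx.le.trans hx) (hy.le.trans hx) with h | h
          · exact h
          · exact (h.eq_of_not_lt fun h' => hy.2 h' hzx).ge
      · rintro (rfl | hz)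
        · exact ⟨hx0, le_rfl⟩
        · exact ⟨hz.1, hz.2.trans hy.le⟩
    have : belowCard x = belowCard y + 1 := by
      rw [belowCard, hset, Set.ncard_insert_of_notMem (fun h => hy.1.not_ge h.2) (Set.toFinite _)]
      rfl
    omega

/-- Let `c` be the element following `x ⊓ u` in the chain below `u`. Then `c ⊓ x = x ⊓ u ⋖ c`, so
semimodularity gives `x ⋖ c ⊔ x`, and minimality identifies `y` with `c ⊔ x`. -/
theorem covBy_of_forall_belowCard [IsUpperModularLattice L] {u v : L}
    (hu : IsChain (· ≤ ·) (Set.Iic u))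
    (hle : ∀ x y : L, x ≤ y ↔ belowCard (x ⊓ u) ≤ belowCard (y ⊓ u) ∧
      belowCard (x ⊓ v) ≤ belowCard (y ⊓ v)) {x y : L}
    (h1 : belowCard (x ⊓ u) < belowCard (y ⊓ u)) (h2 : belowCard (x ⊓ v) ≤ belowCard (y ⊓ v))
    (h3 : ∀ z, belowCard (x ⊓ u) < belowCard (z ⊓ u) → belowCard (x ⊓ v) ≤ belowCard (z ⊓ v) →
      y ≤ z) : x ⋖ y := by
  obtain ⟨c, hcu, hc⟩ := exists_belowCard_eq hu (belowCard (x ⊓ u) + 1)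
    (h1.trans_le (belowCard_mono inf_le_right))
  have hxc : x ⊓ u ≤ c := (belowCard_le_iff hu inf_le_right hcu).1 (by omega)
  have hcx : c ⊓ x = x ⊓ u :=
    le_antisymm (le_inf inf_le_right (inf_le_left.trans hcu)) (le_inf hxc inf_le_left)
  have hcov : c ⊓ x ⋖ c := by
    rw [hcx]
    refine ⟨hxc.lt_of_ne fun h => by rw [h] at hc; omega, fun z hz hz' => ?_⟩
    have := belowCard_strictMono hz
    have := belowCard_strictMono hz'
    omega
  have hy : y = c ⊔ x := by
    refine le_antisymm (h3 _ ?_ (belowCard_mono (inf_le_inf_right _ le_sup_right)))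
      (sup_le ?_ ((hle x y).2 ⟨h1.le, h2⟩))
    · have := belowCard_mono (le_inf le_sup_left hcu : c ≤ (c ⊔ x) ⊓ u)
      omega
    · exact ((belowCard_le_iff hu hcu inf_le_right).1 (by omega : _ ≤ belowCard (y ⊓ u))).trans
        inf_le_left
  rw [hy]
  exact covBy_sup_of_inf_covBy_left hcov

theorem isGridCoordinates_belowCard [IsUpperModularLattice L] {u v : L}
    (hu : IsChain (· ≤ ·) (Set.Iic u)) (hv : IsChain (· ≤ ·) (Set.Iic v)) (hu0 : u ≠ ⊥)
    (hv0 : v ≠ ⊥) (hJ : ∀ c, SupIrred c → c ≤ u ∨ c ≤ v) (hbot : u ⊓ v = ⊥) :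
    IsGridCoordinates (fun x => belowCard (x ⊓ u)) (fun x => belowCard (x ⊓ v))
      (belowCard u) (belowCard v) := by
  have hle : ∀ x y : L, x ≤ y ↔ belowCard (x ⊓ u) ≤ belowCard (y ⊓ u) ∧
      belowCard (x ⊓ v) ≤ belowCard (y ⊓ v) := by
    intro x y
    rw [belowCard_le_iff hu inf_le_right inf_le_right,
      belowCard_le_iff hv inf_le_right inf_le_right]
    refine ⟨fun h => ⟨inf_le_inf_right _ h, inf_le_inf_right _ h⟩, fun h =>
      le_of_forall_supIrred fun c hc hcx => ?_⟩
    rcases hJ c hc with hcu | hcv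
    · exact (le_inf hcx hcu).trans (h.1.trans inf_le_left)
    · exact (le_inf hcx hcv).trans (h.2.trans inf_le_left)
  have hinf : ∀ {w : L}, IsChain (· ≤ ·) (Set.Iic w) → ∀ x y : L,
      belowCard (x ⊓ y ⊓ w) = min (belowCard (x ⊓ w)) (belowCard (y ⊓ w)) := by
    intro w hw x y
    have he : x ⊓ y ⊓ w = (x ⊓ w) ⊓ (y ⊓ w) := inf_inf_distrib_right x y w
    rcases hw.total (inf_le_right : x ⊓ w ≤ w) (inf_le_right : y ⊓ w ≤ w) with h | h
    · rw [he, inf_eq_left.2 h, min_eq_left (belowCard_mono h)]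
    · rw [he, inf_eq_right.2 h, min_eq_right (belowCard_mono h)]
  refine ⟨?_, ?_, @hle, fun x y => ⟨x ⊓ y, hinf hu x y, hinf hv x y⟩, ⟨u ⊔ v, ?_, ?_⟩,
    fun x => belowCard_mono inf_le_right, fun x => belowCard_mono inf_le_right, ?_, ?_,
    covBy_of_forall_belowCard hu hle, fun h1 h2 h3 => covBy_of_forall_belowCard hv
      (fun x y => (hle x y).trans and_comm) h2 h1 fun z hz hz' => h3 z hz' hz⟩
  · exact (Nat.zero_le _).trans_lt (belowCard_strictMono (bot_lt_iff_ne_bot.2 hu0))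
  · exact (Nat.zero_le _).trans_lt (belowCard_strictMono (bot_lt_iff_ne_bot.2 hv0))
  · simp
  · simp
  · intro i hi
    obtain ⟨x, hx, hxi⟩ := exists_belowCard_eq hu i hi
    refine ⟨x, by simpa [inf_eq_left.2 hx] using hxi, ?_⟩
    have : x ⊓ v = ⊥ := le_bot_iff.1 (hbot ▸ inf_le_inf_right v hx)
    simp [this, belowCard_bot]
  · intro i hi
    obtain ⟨x, hx, hxi⟩ := exists_belowCard_eq hv i hi
    refine ⟨x, ?_, by simpa [inf_eq_left.2 hx] using hxi⟩
    have : x ⊓ u = ⊥ := le_bot_iff.1 (by rw [← hbot, inf_comm]; exact inf_le_inf_left u hx)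
    simp [this, belowCard_bot]

end SlimRectangular

theorem IsSlimRectangular.exists_isGridCoordinates {L : Type*} [Lattice L]
    (hL : IsSlimRectangular L) : ∃ (f g : L → ℕ) (M N : ℕ), IsGridCoordinates f g M N := by
  obtain ⟨hfin, ⟨C, D, hC, hD, hJ⟩, hmod, u, v, huv, hcor, hbot, htop⟩ := hL
  let _ : OrderBot L := { bot := u ⊓ v, bot_le := hbot }
  have hb : u ⊓ v = ⊥ := rfl
  have hu : SupIrred u := by
    have : u ∈ {x : L | SupIrred x ∧ InfIrred x} := hcor ▸ Or.inl rfl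
    exact this.1
  have hv : SupIrred v := by
    have : v ∈ {x : L | SupIrred x ∧ InfIrred x} := hcor ▸ Or.inr rfl
    exact this.1
  have huv' : ¬ u ≤ v := fun h => hu.1 (by rw [isMin_iff_eq_bot, ← hb, inf_eq_left.2 h])
  have hvu' : ¬ v ≤ u := fun h => hv.1 (by rw [isMin_iff_eq_bot, ← hb, inf_eq_right.2 h])
  -- The corners are incomparable, hence lie in different chains; only the naming of the chains has
  -- to be adjusted.
  have main : ∀ C D : Set L, IsChain (· ≤ ·) C → IsChain (· ≤ ·) D →
      {x : L | SupIrred x} = C ∪ D → u ∈ C → v ∈ D →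
      ∃ (f g : L → ℕ) (M N : ℕ), IsGridCoordinates f g M N := by
    intro C D hC hD hJ huC hvD
    obtain ⟨h1, h2⟩ := supIrred_le_corners hC hD hJ huC hvD hcor hb htop
    have hJ' : ∀ c, SupIrred c → c ∈ C ∨ c ∈ D := fun c hc => by
      have : c ∈ C ∪ D := hJ ▸ hc
      exact this
    exact ⟨_, _, _, _, isGridCoordinates_belowCard (isChain_Iic_of_chains hC hJ' h2 hb)
      (isChain_Iic_of_chains hD (fun c hc => (hJ' c hc).symm) h1 (by rw [inf_comm, hb]))
      (fun h => hu.1 (isMin_iff_eq_bot.2 h)) (fun h => hv.1 (isMin_iff_eq_bot.2 h))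
      (fun c hc => (hJ' c hc).imp (h1 c) (h2 c)) hb⟩
  have hu' : u ∈ C ∪ D := hJ ▸ hu
  have hv' : v ∈ C ∪ D := hJ ▸ hv
  rcases hu' with hu' | hu' <;> rcases hv' with hv' | hv'
  · exact absurd (hC.total hu' hv') (by tauto)
  · exact main C D hC hD hJ hu' hv'
  · exact main D C hD hC (by rw [hJ, Set.union_comm]) hu' hv'
  · exact absurd (hD.total hu' hv') (by tauto)

/-! ### Length and height in grid coordinates -/

/-- In an order with finite coheights that satisfies the upper covering condition, the coheight drops
by one along a covering. -/
theorem coheight_eq_add_one_of_covBy {P : Type*} [PartialOrder P]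
    (hfin : ∀ x : P, Order.coheight x ≠ ⊤)
    (hP : ∀ z a b : P, z ⋖ a → z ⋖ b → a ≠ b → ∃ w, a ⋖ w ∧ b ⋖ w) {x y : P} (hxy : x ⋖ y) :
    Order.coheight x = Order.coheight y + 1 := by
  have key : ∀ (n : ℕ) (x y : P), x ⋖ y → Order.coheight x = n →
      Order.coheight x = Order.coheight y + 1 := by
    intro n
    induction n with
    | zero =>
      intro x y hxy hx
      exact absurd hxy.lt (Order.coheight_eq_zero.1 (by simpa using hx)).not_lt
    | succ n ih =>
      intro x y hxy hx
      obtain ⟨-, ⟨a, hxa, ha⟩, -⟩ := Order.coheight_eq_coe_add_one_iff.1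
        (by simpa using hx : Order.coheight x = (n : ℕ∞) + 1)
      have hcov : x ⋖ a := by
        refine ⟨hxa, fun z hxz hza => ?_⟩
        have h1 := Order.coheight_add_one_le hxz
        have h2 := Order.coheight_add_one_le hza
        rw [hx] at h1
        rw [ha] at h2
        have h3 : ((n : ℕ∞) + 1) + 1 ≤ ((n + 1 : ℕ) : ℕ∞) := (add_le_add_left h2 1).trans h1
        norm_cast at h3
        omega
      refine le_antisymm ?_ (Order.coheight_add_one_le hxy.lt)
      rw [hx, Nat.cast_add, Nat.cast_one]
      refine add_le_add_left ?_ 1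
      -- The element `a` realizes the coheight of `x`. A common cover `w` of `a` and `y` transfers
      -- the value: induction applies to `a ⋖ w`, and `w` lies above `y`.
      rcases eq_or_ne a y with rfl | hne
      · exact ha.ge
      · obtain ⟨w, haw, hyw⟩ := hP x a y hcov hxy hne
        rw [← ha, ih a w haw ha]
        exact Order.coheight_add_one_le hyw.lt
  obtain ⟨n, hn⟩ := ENat.ne_top_iff_exists.1 (hfin x)
  exact key n x y hxy hn.symm

namespace IsGridCoordinates

section Poset

variable {P : Type*} [PartialOrder P] {f g : P → ℕ} {M N : ℕ}

theorem exists_covBy_covBy (h : IsGridCoordinates f g M N) (z a b : P) (hza : z ⋖ a)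
    (hzb : z ⋖ b) (hab : a ≠ b) : ∃ w, a ⋖ w ∧ b ⋖ w := by
  obtain ⟨inst, rfl⟩ := h.exists_lattice
  have := h.isUpperModularLattice
  have hz : z ≤ a ⊓ b := le_inf hza.le hzb.le
  have hinf : a ⊓ b = z := by
    by_contra hne
    have hlt := hz.lt_of_ne' hne
    have ha : a ⊓ b = a := inf_le_left.eq_of_not_lt fun h => hza.2 hlt h
    have hb : a ⊓ b = b := inf_le_right.eq_of_not_lt fun h => hzb.2 hlt h
    exact hab (ha.symm.trans hb)
  exact ⟨a ⊔ b, covBy_sup_of_inf_covBy_right (hinf ▸ hzb), covBy_sup_of_inf_covBy_left (hinf ▸ hza)⟩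

theorem coheight_eq_add_one (h : IsGridCoordinates f g M N) {x y : P} (hxy : x ⋖ y) :
    Order.coheight x = Order.coheight y + 1 := by
  have := h.finite
  have := Fintype.ofFinite P
  refine coheight_eq_add_one_of_covBy (fun z => ne_top_of_le_ne_top (ENat.natCast_ne_top
    (Fintype.card P)) (Order.coheight_le fun p _ => ?_)) h.exists_covBy_covBy hxy
  exact_mod_cast p.length_lt_card.le

/-- The length of a poset with grid coordinates, computed along the chain that goes up the lower
edge of the grid to the column `p` and then climbs this column to `t`. -/
theorem krullDim_eq (h : IsGridCoordinates f g M N) {p n : ℕ} {t : P} (hn : 0 < n) (ht : f t = p)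
    (htn : n ≤ g t) (hcol : ∀ j < n, ∃ x, f x = p ∧ g x = j)
    (hmin : ∀ x, f x = p → n ≤ g x → t ≤ x) :
    Order.krullDim P = ((Order.coheight t + n + p : ℕ∞) : WithBot ℕ∞) := by
  -- Climbing column `p`: it has points in rows `0, …, n - 1`, and the next one is `t`, possibly
  -- much higher. Hence row `n - 1` is covered by `t`, and each row contributes one step.
  have hA : ∀ (d : ℕ) (x : P), f x = p → g x + d + 1 = n →
      Order.coheight x = Order.coheight t + (d + 1 : ℕ) := by
    intro d
    induction d with
    | zero =>
      intro x hx hxn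
      refine h.coheight_eq_add_one ⟨h.lt_iff.2 (by omega), fun z hxz hzt => hzt.not_ge ?_⟩
      rw [h.lt_iff] at hxz hzt
      exact hmin z (by omega) (by omega)
    | succ d ih =>
      intro x hx hxn
      obtain ⟨y, hy, hy'⟩ := hcol (g x + 1) (by omega)
      rw [h.coheight_eq_add_one (h.swap.covBy_of_add_one_fst hy' (by omega) : x ⋖ y),
        ih y hy (by omega)]
      push_cast
      ring
  have hB : ∀ (d : ℕ) (x : P), g x = 0 → f x + d = p →
      Order.coheight x = Order.coheight t + n + d := by
    intro d
    induction d with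
    | zero =>
      intro x hx hxp
      rw [hA (n - 1) x hxp (by omega), Nat.sub_add_cancel hn]
      simp
    | succ d ih =>
      intro x hx hxp
      obtain ⟨y, hy, hy'⟩ := h.exists_fst (f x + 1) (by have := h.le_fst t; omega)
      rw [h.coheight_eq_add_one (h.covBy_of_add_one_fst hy (by omega) : x ⋖ y),
        ih y hy' (by omega)]
      push_cast
      ring
  obtain ⟨o, ho, ho'⟩ := h.exists_fst 0 (Nat.zero_le _)
  let _ : OrderBot P := { bot := o, bot_le := fun x => h.le_iff.2 (by omega) }
  have := Order.coheight_bot_eq_krullDim (α := P)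
  rw [← this, WithBot.coe_inj]
  exact hB p o ho' (by omega)

/-- If the grid below `t` is full, then the height of `t` is the sum of its coordinates. -/
theorem height_eq (h : IsGridCoordinates f g M N) {t : P}
    (hfull : ∀ i ≤ f t, ∀ j ≤ g t, ∃ x, f x = i ∧ g x = j) :
    Order.height t = (f t + g t : ℕ) := by
  refine le_antisymm ?_ ?_
  -- The coordinate sum bounds the height from above; in a full grid it can be lowered by exactly
  -- one at a time, which gives the other bound.
  · have hmono : StrictMono fun x => f x + g x := fun x y hxy => by
      rw [h.lt_iff] at hxy
      simp only
      omega
    exact (Order.height_le_height_apply_of_strictMono _ hmono t).trans (Order.height_nat _).le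
  · have key : ∀ (d : ℕ) (x : P), x ≤ t → f x + g x = d → (d : ℕ∞) ≤ Order.height x := by
      intro d
      induction d with
      | zero => simp
      | succ d ih =>
        intro x hx hd
        have hx' := h.le_iff.1 hx
        obtain ⟨y, hy, hyd⟩ : ∃ y, y < x ∧ f y + g y = d := by
          rcases Nat.eq_zero_or_pos (f x) with h0 | h0
          · obtain ⟨y, hy⟩ := hfull (f x) hx'.1 (g x - 1) (by omega)
            exact ⟨y, h.lt_iff.2 (by omega), by omega⟩
          · obtain ⟨y, hy⟩ := hfull (f x - 1) (by omega) (g x) hx'.2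
            exact ⟨y, h.lt_iff.2 (by omega), by omega⟩
        have := ih y (hy.le.trans hx) hyd
        push_cast
        exact (add_le_add_left this 1).trans (Order.height_add_one_le hy)
    exact key _ t le_rfl rfl

end Poset

/-! ### Distributive ideals are full grids -/

section Lattice

open FourCell

variable {L : Type*} [Lattice L] {f g : L → ℕ} {M N : ℕ}

/-- The point `(i, j)` is the join of edge points `c = (i, 0)` and `d = (0, j)`. This join gains no
first coordinate: its projection `e` to the edge satisfies `e = (e ⊓ c) ⊔ (e ⊓ d) = c` by
distributivity, and symmetrically for the second. -/
theorem exists_of_distributive (h : IsGridCoordinates f g M N) {t : L}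
    (ht : ∀ x y z : L, x ≤ t → y ≤ t → z ≤ t → x ⊓ (y ⊔ z) = (x ⊓ y) ⊔ (x ⊓ z)) :
    ∀ i ≤ f t, ∀ j ≤ g t, ∃ x, f x = i ∧ g x = j := by
  have key : ∀ {f g : L → ℕ} {M N : ℕ}, IsGridCoordinates f g M N → ∀ {c d : L}, c ≤ t → d ≤ t →
      g c = 0 → f d = 0 → f (c ⊔ d) = f c := by
    intro f g M N h c d hc hd hc0 hd0
    have hcd := h.fst_mono (le_sup_left : c ≤ c ⊔ d)
    obtain ⟨e, he, he'⟩ := h.exists_fst (f (c ⊔ d)) (h.le_fst _)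
    have het : e ≤ c ⊔ d := h.le_iff.2 (by omega)
    have h1 := ht e c d (het.trans (sup_le hc hd)) hc hd
    have hec : e ⊓ c = c := inf_eq_right.2 (h.le_iff.2 (by omega))
    have hed : e ⊓ d ≤ c := h.le_iff.2 (by rw [h.fst_inf, h.snd_inf]; omega)
    rw [inf_eq_left.2 het, hec, sup_eq_left.2 hed] at h1
    rw [h1] at he
    exact he.symm
  intro i hi j hj
  obtain ⟨c, hc, hc'⟩ := h.exists_fst i (hi.trans (h.le_fst t))
  obtain ⟨d, hd, hd'⟩ := h.exists_snd j (hj.trans (h.le_snd t))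
  have hct : c ≤ t := h.le_iff.2 (by omega)
  have hdt : d ≤ t := h.le_iff.2 (by omega)
  exact ⟨c ⊔ d, (key h hct hdt hc' hd).trans hc,
    by rw [sup_comm]; exact (key h.swap hdt hct hd hc').trans hd'⟩

/-- The lower covers of an element with a full grid below it. -/
theorem coords_of_covBy (h : IsGridCoordinates f g M N) {t x : L}
    (hfull : ∀ i ≤ f t, ∀ j ≤ g t, ∃ x, f x = i ∧ g x = j) (hx : x ⋖ t) :
    (f x + 1 = f t ∧ g x = g t) ∨ (f x = f t ∧ g x + 1 = g t) := by
  have hlt := h.lt_iff.1 hx.1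
  rcases hlt.2.2 with hf | hg
  · obtain ⟨y, hy, hy'⟩ := hfull (f x + 1) hf (g x) hlt.2.1
    have hyt : y = t := by
      by_contra hne
      exact hx.2 (c := y) (h.lt_iff.2 (by omega)) ((h.le_iff.2 (by omega)).lt_of_ne hne)
    rw [hyt] at hy hy'
    omega
  · obtain ⟨y, hy, hy'⟩ := hfull (f x) hlt.1 (g x + 1) hg
    have hyt : y = t := by
      by_contra hne
      exact hx.2 (c := y) (h.lt_iff.2 (by omega)) ((h.le_iff.2 (by omega)).lt_of_ne hne)
    rw [hyt] at hy hy'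
    omega

end Lattice

end IsGridCoordinates

/-! ### The cell in the grid corner and its trajectories -/

namespace FourCell

variable {L : Type*} [Lattice L]

theorem left_ne_right (T : FourCell L) : T.left ≠ T.right := fun he =>
  T.bot_covBy_left.lt.ne (by rw [← T.left_inf_right, ← he, inf_idem])

/-- The 4-cell with left and right exchanged. -/
def flip (H : FourCell L) : FourCell L where
  bot := H.bot
  left := H.right
  right := H.left
  top := H.top
  left_inf_right := by rw [inf_comm, H.left_inf_right]
  left_sup_right := by rw [sup_comm, H.left_sup_right]
  bot_covBy_left := H.bot_covBy_right
  bot_covBy_right := H.bot_covBy_left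
  left_covBy_top := H.right_covBy_top
  right_covBy_top := H.left_covBy_top

/-- The 4-cell `H` sits in the corner of a full grid with `m + 1` columns and `n + 1` rows. -/
structure IsGridCorner (H : FourCell L) (f g : L → ℕ) (m n : ℕ) : Prop where
  pos_fst : 0 < m
  pos_snd : 0 < n
  fst_top : f H.top = m
  snd_top : g H.top = n
  fst_left : f H.left = m
  snd_left : g H.left + 1 = n
  fst_right : f H.right + 1 = m
  snd_right : g H.right = n
  fst_bot : f H.bot + 1 = m
  snd_bot : g H.bot + 1 = n
  full : ∀ i ≤ m, ∀ j ≤ n, ∃ x, f x = i ∧ g x = j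

theorem IsGridCorner.flip {H : FourCell L} {f g : L → ℕ} {m n : ℕ} (c : H.IsGridCorner f g m n) :
    H.flip.IsGridCorner g f n m where
  pos_fst := c.pos_snd
  pos_snd := c.pos_fst
  fst_top := c.snd_top
  snd_top := c.fst_top
  fst_left := c.snd_right
  snd_left := c.fst_right
  fst_right := c.snd_left
  snd_right := c.fst_left
  fst_bot := c.snd_bot
  snd_bot := c.fst_bot
  full i hi j hj := (c.full j hj i hi).imp fun _ => And.symm

theorem exists_isGridCorner (hL : IsSlimRectangular L) {H : FourCell L} (hH : H.IsDistributive) :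
    ∃ (f g : L → ℕ) (M N m n : ℕ), IsGridCoordinates f g M N ∧ H.IsGridCorner f g m n := by
  obtain ⟨f, g, M, N, h⟩ := hL.exists_isGridCoordinates
  have hfull := h.exists_of_distributive hH
  have hl := h.coords_of_covBy hfull H.left_covBy_top
  have hr := h.coords_of_covBy hfull H.right_covBy_top
  have hne : ¬ (f H.left = f H.right ∧ g H.left = g H.right) := fun he =>
    H.left_ne_right (h.ext he.1 he.2)
  have hbf := h.fst_inf H.left H.right
  have hbg := h.snd_inf H.left H.right
  rw [H.left_inf_right] at hbf hbg
  -- The two distinct lower covers of `H.top` lower different coordinates. If `H.left` lowers the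
  -- first one, the coordinates are exchanged.
  by_cases hc : f H.left = f H.top
  · exact ⟨f, g, M, N, f H.top, g H.top, h, by omega, by omega, rfl, rfl, by omega, by omega,
      by omega, by omega, by omega, by omega, hfull⟩
  · exact ⟨g, f, N, M, g H.top, f H.top, h.swap, by omega, by omega, rfl, rfl, by omega, by omega,
      by omega, by omega, by omega, by omega,
      fun i hi j hj => (hfull j hj i hi).imp fun _ => And.symm⟩

namespace IsGridCorner

variable {H : FourCell L} {f g : L → ℕ} {M N m n : ℕ}

/-- A step preserves the strip: the top of the 4-cell has only two lower covers in the full grid,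
and one is the other end of the horizontal edge, so `T.right` is one row below in column `m`. -/
theorem coords_of_mem_leftEdges (c : H.IsGridCorner f g m n) (h : IsGridCoordinates f g M N)
    {e : L × L} (he : e ∈ H.leftEdges) :
    f e.1 + 1 = m ∧ f e.2 = m ∧ g e.1 = g e.2 ∧ g e.2 < n := by
  change Relation.ReflTransGen StepDown (H.bot, H.left) e at he
  induction he with
  | refl =>
    have h1 := c.fst_bot
    have h2 := c.snd_bot
    have h3 := c.fst_left
    have h4 := c.snd_left
    simp only
    omega
  | tail _ hstep ih =>
    obtain ⟨T, rfl, rfl⟩ := hstep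
    simp only at ih ⊢
    have hr := h.coords_of_covBy (fun i hi j hj => c.full i (by omega) j (by omega))
      T.right_covBy_top
    have hne : ¬ (f T.left = f T.right ∧ g T.left = g T.right) := fun he =>
      T.left_ne_right (h.ext he.1 he.2)
    have hbf := h.fst_inf T.left T.right
    have hbg := h.snd_inf T.left T.right
    rw [T.left_inf_right] at hbf hbg
    omega

/-- Two points on the left of neighbouring rows form a 4-cell with the points next to them. -/
theorem stepDown (h : IsGridCoordinates f g M N) {e e' : L × L} (h1 : f e.1 + 1 = f e.2)
    (h2 : g e.1 = g e.2) (h3 : f e'.1 = f e.1) (h4 : f e'.2 = f e.2) (h5 : g e'.1 + 1 = g e.1)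
    (h6 : g e'.2 + 1 = g e.2) : StepDown e e' := by
  refine ⟨⟨e'.1, e.1, e'.2, e.2, h.ext ?_ ?_, ?_, h.swap.covBy_of_add_one_fst ?_ ?_,
    h.covBy_of_add_one_fst ?_ ?_, h.covBy_of_add_one_fst ?_ ?_,
    h.swap.covBy_of_add_one_fst ?_ ?_⟩, rfl, rfl⟩
  any_goals omega
  · rw [h.fst_inf]; omega
  · rw [h.snd_inf]; omega
  · refine le_antisymm (sup_le (h.le_iff.2 (by omega)) (h.le_iff.2 (by omega))) (h.le_iff.2 ?_)
    have h7 := h.snd_mono (le_sup_left : e.1 ≤ e.1 ⊔ e'.2)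
    have h8 := h.fst_mono (le_sup_right : e'.2 ≤ e.1 ⊔ e'.2)
    omega

theorem mem_leftEdges (c : H.IsGridCorner f g m n) (h : IsGridCoordinates f g M N) {e : L × L}
    (h1 : f e.1 + 1 = m) (h2 : f e.2 = m) (h3 : g e.1 = g e.2) (h4 : g e.2 < n) :
    e ∈ H.leftEdges := by
  have hb1 := c.fst_bot
  have hb2 := c.snd_bot
  have hl1 := c.fst_left
  have hl2 := c.snd_left
  have key : ∀ (d : ℕ) (e : L × L), f e.1 + 1 = m → f e.2 = m → g e.1 = g e.2 →
      g e.2 + d + 1 = n → e ∈ H.leftEdges := by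
    intro d
    induction d with
    | zero =>
      intro e h1 h2 h3 h4
      have : e = (H.bot, H.left) :=
        Prod.ext (h.ext (by dsimp only; omega) (by dsimp only; omega))
          (h.ext (by dsimp only; omega) (by dsimp only; omega))
      rw [this]
      exact Relation.ReflTransGen.refl
    | succ d ih =>
      intro e h1 h2 h3 h4
      obtain ⟨x, hx, hx'⟩ := c.full (f e.1) (by omega) (g e.1 + 1) (by omega)
      obtain ⟨y, hy, hy'⟩ := c.full (f e.2) (by omega) (g e.2 + 1) (by omega)
      refine Relation.ReflTransGen.tail (ih (x, y) ?_ ?_ ?_ ?_) (stepDown h ?_ ?_ ?_ ?_ ?_ ?_)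
      all_goals
        simp only
        omega
  exact key (n - 1 - g e.2) e h1 h2 h3 (by omega)

theorem coords_of_mem_rightEdges (c : H.IsGridCorner f g m n) (h : IsGridCoordinates f g M N)
    {e : L × L} (he : e ∈ H.rightEdges) :
    g e.1 + 1 = n ∧ g e.2 = n ∧ f e.1 = f e.2 ∧ f e.2 < m :=
  c.flip.coords_of_mem_leftEdges h.swap he

theorem mem_rightEdges (c : H.IsGridCorner f g m n) (h : IsGridCoordinates f g M N) {e : L × L}
    (h1 : g e.1 + 1 = n) (h2 : g e.2 = n) (h3 : f e.1 = f e.2) (h4 : f e.2 < m) :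
    e ∈ H.rightEdges :=
  c.flip.mem_leftEdges h.swap h1 h2 h3 h4

theorem card_leftEdges (c : H.IsGridCorner f g m n) (h : IsGridCoordinates f g M N) :
    Nat.card H.leftEdges = n := by
  have hbij : Function.Bijective fun e : H.leftEdges =>
      (⟨g e.1.2, (c.coords_of_mem_leftEdges h e.2).2.2.2⟩ : Fin n) := by
    constructor
    · rintro ⟨e, he⟩ ⟨e', he'⟩ hee
      have h1 := c.coords_of_mem_leftEdges h he
      have h2 := c.coords_of_mem_leftEdges h he'
      simp only [Fin.mk.injEq] at hee
      exact Subtype.ext (Prod.ext (h.ext (by dsimp only; omega) (by dsimp only; omega))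
        (h.ext (by dsimp only; omega) (by dsimp only; omega)))
    · rintro ⟨j, hj⟩
      have hm := c.pos_fst
      obtain ⟨x, hx, hx'⟩ := c.full (m - 1) (by omega) j hj.le
      obtain ⟨y, hy, hy'⟩ := c.full m le_rfl j hj.le
      exact ⟨⟨(x, y), c.mem_leftEdges h (by simp only; omega) hy (by simp only; omega)
        (by simp only; omega)⟩, Fin.ext hy'⟩
  rw [Nat.card_eq_of_bijective _ hbij, Nat.card_eq_fintype_card, Fintype.card_fin]

theorem card_rightEdges (c : H.IsGridCorner f g m n) (h : IsGridCoordinates f g M N) :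
    Nat.card H.rightEdges = m :=
  c.flip.card_leftEdges h.swap

end IsGridCorner

end FourCell

/-! ### Coordinates and order of the multifork extension -/

namespace FourCell

namespace MultiforkExtension

variable {L : Type*} [Lattice L] {H : FourCell L} {k : ℕ}

/-- The position of the `i`-th column of the grid after `k` new columns have been inserted before
the `m`-th one. -/
def shift (m k i : ℕ) : ℕ := if i < m then i else i + k

/-- The first coordinate on the multifork extension. -/
def fst (f : L → ℕ) : MultiforkExtension H k → ℕ
  | old x => shift (f H.top) k (f x)
  -- The index is reversed because the new elements on a left edge decrease as `i` grows.
  | onLeft _ _ i => f H.top + (k - 1 - i)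
  | onRight e _ _ => f e.2
  | inner _ j _ => f H.top + (k - 1 - j)

/-- The second coordinate on the multifork extension. -/
def snd (g : L → ℕ) : MultiforkExtension H k → ℕ
  | old x => shift (g H.top) k (g x)
  | onLeft e _ _ => g e.2
  | onRight _ _ i => g H.top + i
  | inner i _ _ => g H.top + i

theorem old_le_old {x y : L} (h : x ≤ y) : (old x : MultiforkExtension H k) ≤ old y :=
  Relation.ReflTransGen.single (.old_old x y h)

theorem old_le_onLeft {e : L × L} (he : e ∈ H.leftEdges) (i : Fin k) {x : L} (h : x ≤ e.1) :
    old x ≤ onLeft e he i :=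
  (old_le_old h).trans (Relation.ReflTransGen.single (.old_onLeft e he i))

theorem onLeft_le_old {e : L × L} (he : e ∈ H.leftEdges) (i : Fin k) {x : L} (h : e.2 ≤ x) :
    onLeft e he i ≤ old x :=
  le_trans (Relation.ReflTransGen.single (.onLeft_old e he i)) (old_le_old h)

theorem old_le_onRight {e : L × L} (he : e ∈ H.rightEdges) (i : Fin k) {x : L} (h : x ≤ e.1) :
    old x ≤ onRight e he i :=
  (old_le_old h).trans (Relation.ReflTransGen.single (.old_onRight e he i))

theorem onRight_le_old {e : L × L} (he : e ∈ H.rightEdges) (i : Fin k) {x : L} (h : e.2 ≤ x) :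
    onRight e he i ≤ old x :=
  le_trans (Relation.ReflTransGen.single (.onRight_old e he i)) (old_le_old h)

theorem bot_left_mem : (H.bot, H.left) ∈ H.leftEdges := Relation.ReflTransGen.refl

theorem bot_right_mem : (H.bot, H.right) ∈ H.rightEdges := Relation.ReflTransGen.refl

theorem onLeft_bot_left_le_inner {l i j : Fin k} (hij : i ≤ j) (h : j ≤ l) :
    onLeft (H.bot, H.left) bot_left_mem l ≤ inner i j hij :=
  le_trans (b := onLeft (H.bot, H.left) bot_left_mem j)
    (Relation.ReflTransGen.single (.onLeft_chain _ _ l j h))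
    (Relation.ReflTransGen.single (.onLeft_inner bot_left_mem i j hij))

theorem onRight_bot_right_le_inner {l i j : Fin k} (hij : i ≤ j) (h : l ≤ i) :
    onRight (H.bot, H.right) bot_right_mem l ≤ inner i j hij :=
  le_trans (b := onRight (H.bot, H.right) bot_right_mem i)
    (Relation.ReflTransGen.single (.onRight_chain _ _ l i h))
    (Relation.ReflTransGen.single (.onRight_inner bot_right_mem i j hij))

theorem old_le_inner {i j : Fin k} (hij : i ≤ j) {x : L} (h : x ≤ H.bot) :
    old x ≤ inner (H := H) i j hij :=
  (old_le_onLeft bot_left_mem j h).trans (onLeft_bot_left_le_inner hij le_rfl)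

theorem inner_le_old {i j : Fin k} (hij : i ≤ j) {x : L} (h : H.top ≤ x) :
    inner (H := H) i j hij ≤ old x :=
  le_trans (Relation.ReflTransGen.single (.inner_old i j hij)) (old_le_old h)

end MultiforkExtension

namespace IsGridCorner

open MultiforkExtension

variable {L : Type*} [Lattice L] {H : FourCell L} {f g : L → ℕ} {M N m n k : ℕ}

/-- The cross relations climb the trajectory row by row at fixed index; the chain on the last edge
then adjusts the index. -/
theorem onLeft_le_onLeft (c : H.IsGridCorner f g m n) (h : IsGridCoordinates f g M N)
    {e e' : L × L} (he : e ∈ H.leftEdges) (he' : e' ∈ H.leftEdges) {i i' : Fin k} (hi : i' ≤ i)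
    (hg : g e.2 ≤ g e'.2) : onLeft e he i ≤ onLeft e' he' i' := by
  refine le_trans ?_ (Relation.ReflTransGen.single (.onLeft_chain e' he' i i' hi))
  have key : ∀ (d : ℕ) (e : L × L) (he : e ∈ H.leftEdges), g e.2 + d = g e'.2 →
      onLeft e he i ≤ onLeft e' he' i := by
    have h1 := c.coords_of_mem_leftEdges h he'
    intro d
    induction d with
    | zero =>
      intro e he hd
      have h2 := c.coords_of_mem_leftEdges h he
      have hee : e = e' := Prod.ext (h.ext (by omega) (by omega)) (h.ext (by omega) (by omega))
      subst hee
      exact le_rfl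
    | succ d ih =>
      intro e he hd
      have h2 := c.coords_of_mem_leftEdges h he
      obtain ⟨x, hx, hx'⟩ := c.full (f e.1) (by omega) (g e.1 + 1) (by omega)
      obtain ⟨y, hy, hy'⟩ := c.full (f e.2) (by omega) (g e.2 + 1) (by omega)
      have hxy : (x, y) ∈ H.leftEdges := c.mem_leftEdges h (by dsimp only; omega)
        (by dsimp only; omega) (by dsimp only; omega) (by dsimp only; omega)
      refine le_trans (Relation.ReflTransGen.single (.onLeft_cross (x, y) e hxy he
        (stepDown h ?_ ?_ ?_ ?_ ?_ ?_) i)) (ih (x, y) hxy ?_)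
      all_goals
        dsimp only
        omega
  exact key (g e'.2 - g e.2) e he (by omega)

theorem onRight_le_onRight (c : H.IsGridCorner f g m n) (h : IsGridCoordinates f g M N)
    {e e' : L × L} (he : e ∈ H.rightEdges) (he' : e' ∈ H.rightEdges) {i i' : Fin k} (hi : i ≤ i')
    (hf : f e.2 ≤ f e'.2) : onRight e he i ≤ onRight e' he' i' := by
  refine le_trans ?_ (Relation.ReflTransGen.single (.onRight_chain e' he' i i' hi))
  have key : ∀ (d : ℕ) (e : L × L) (he : e ∈ H.rightEdges), f e.2 + d = f e'.2 →
      onRight e he i ≤ onRight e' he' i := by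
    have h1 := c.coords_of_mem_rightEdges h he'
    intro d
    induction d with
    | zero =>
      intro e he hd
      have h2 := c.coords_of_mem_rightEdges h he
      have hee : e = e' := Prod.ext (h.ext (by omega) (by omega)) (h.ext (by omega) (by omega))
      subst hee
      exact le_rfl
    | succ d ih =>
      intro e he hd
      have h2 := c.coords_of_mem_rightEdges h he
      obtain ⟨x, hx, hx'⟩ := c.full (f e.1 + 1) (by omega) (g e.1) (by omega)
      obtain ⟨y, hy, hy'⟩ := c.full (f e.2 + 1) (by omega) (g e.2) (by omega)
      have hxy : (x, y) ∈ H.rightEdges := c.mem_rightEdges h (by dsimp only; omega)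
        (by dsimp only; omega) (by dsimp only; omega) (by dsimp only; omega)
      refine le_trans (Relation.ReflTransGen.single (.onRight_cross (x, y) e hxy he
        (stepDown h.swap ?_ ?_ ?_ ?_ ?_ ?_) i)) (ih (x, y) hxy ?_)
      all_goals
        dsimp only
        omega
  exact key (f e'.2 - f e.2) e he (by omega)

theorem inner_le_inner {i j i' j' : Fin k} (hij : i ≤ j) (hij' : i' ≤ j') (hi : i ≤ i')
    (hj : j' ≤ j) : inner (H := H) i j hij ≤ inner i' j' hij' :=
  Relation.ReflTransGen.single (.inner_inner i j i' j' hij hij' hi hj)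

theorem le_of_step (c : H.IsGridCorner f g m n) (h : IsGridCoordinates f g M N)
    {a b : MultiforkExtension H k} (hab : Step a b) :
    fst f a ≤ fst f b ∧ snd g a ≤ snd g b := by
  have c1 := c.fst_top
  have c2 := c.snd_top
  have c3 := c.fst_left
  have c4 := c.snd_left
  have c5 := c.fst_right
  have c6 := c.snd_right
  cases hab with
  | old_old x y hxy =>
    rw [h.le_iff] at hxy
    simp only [fst, snd, shift]
    split_ifs <;> omega
  | old_onLeft e he i | onLeft_old e he i | onLeft_chain e he i i' hi =>
    have h1 := c.coords_of_mem_leftEdges h he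
    simp only [fst, snd, shift]
    try split_ifs
    all_goals omega
  | old_onRight e he i | onRight_old e he i | onRight_chain e he i i' hi =>
    have h1 := c.coords_of_mem_rightEdges h he
    simp only [fst, snd, shift]
    try split_ifs
    all_goals omega
  | onLeft_cross e e' he he' hee i | onRight_cross e e' he he' hee i =>
    obtain ⟨T, rfl, rfl⟩ := hee
    have h1 := h.le_iff.1 T.right_covBy_top.le
    simp only [fst, snd]
    omega
  | onLeft_inner he i j hij | onRight_inner he i j hij | inner_inner i j i' j' hij hij' hi hj =>
    simp only [fst, snd]
    omega
  | inner_old i j hij =>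
    simp only [fst, snd, shift]
    split_ifs <;> omega

/-- Every generating relation is monotone in both coordinates. Conversely, each comparison of
coordinates is either realized by a short path of generators or impossible, as from a left edge
(column at least `m`) to a right edge (column below `m`). -/
theorem multifork_le_iff (c : H.IsGridCorner f g m n) (h : IsGridCoordinates f g M N)
    {a b : MultiforkExtension H k} : a ≤ b ↔ fst f a ≤ fst f b ∧ snd g a ≤ snd g b := by
  constructor
  · intro hab
    change Relation.ReflTransGen Step a b at hab
    induction hab with
    | refl => exact ⟨le_rfl, le_rfl⟩
    | tail _ hs ih =>
      have := c.le_of_step h hs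
      exact ⟨ih.1.trans this.1, ih.2.trans this.2⟩
  · rintro ⟨h1, h2⟩
    have c1 := c.fst_top
    have c2 := c.snd_top
    have c3 := c.fst_left
    have c4 := c.snd_left
    have c5 := c.fst_right
    have c6 := c.snd_right
    have c7 := c.fst_bot
    have c8 := c.snd_bot
    cases a with
    | old x =>
      cases b with
      | old y =>
        simp only [fst, snd, shift] at h1 h2
        refine old_le_old (h.le_iff.2 ?_)
        split_ifs at h1 h2 <;> omega
      | onLeft e he i =>
        have he' := c.coords_of_mem_leftEdges h he
        simp only [fst, snd, shift] at h1 h2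
        refine old_le_onLeft he i (h.le_iff.2 ?_)
        split_ifs at h1 h2 <;> omega
      | onRight e he i =>
        have he' := c.coords_of_mem_rightEdges h he
        simp only [fst, snd, shift] at h1 h2
        refine old_le_onRight he i (h.le_iff.2 ?_)
        split_ifs at h1 h2 <;> omega
      | inner i j hij =>
        simp only [fst, snd, shift] at h1 h2
        refine old_le_inner hij (h.le_iff.2 ?_)
        split_ifs at h1 h2 <;> omega
    | onLeft e he i =>
      have he1 := c.coords_of_mem_leftEdges h he
      cases b with
      | old y =>
        simp only [fst, snd, shift] at h1 h2
        refine onLeft_le_old he i (h.le_iff.2 ?_)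
        split_ifs at h1 h2 <;> omega
      | onLeft e' he' i' =>
        simp only [fst, snd] at h1 h2
        exact c.onLeft_le_onLeft h he he' (by omega) h2
      | onRight e' he' i' =>
        have he2 := c.coords_of_mem_rightEdges h he'
        simp only [fst, snd] at h1 h2
        omega
      | inner i' j' hij' =>
        simp only [fst, snd] at h1 h2
        exact (c.onLeft_le_onLeft h he bot_left_mem le_rfl (by dsimp only; omega)).trans
          (onLeft_bot_left_le_inner hij' (by omega))
    | onRight e he i =>
      have he1 := c.coords_of_mem_rightEdges h he
      cases b with
      | old y =>
        simp only [fst, snd, shift] at h1 h2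
        refine onRight_le_old he i (h.le_iff.2 ?_)
        split_ifs at h1 h2 <;> omega
      | onLeft e' he' i' =>
        have he2 := c.coords_of_mem_leftEdges h he'
        simp only [fst, snd] at h1 h2
        omega
      | onRight e' he' i' =>
        simp only [fst, snd] at h1 h2
        exact c.onRight_le_onRight h he he' (by omega) h1
      | inner i' j' hij' =>
        simp only [fst, snd] at h1 h2
        exact (c.onRight_le_onRight h he bot_right_mem le_rfl (by dsimp only; omega)).trans
          (onRight_bot_right_le_inner hij' (by omega))
    | inner i j hij =>
      cases b with
      | old y =>
        simp only [fst, snd, shift] at h1 h2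
        refine inner_le_old hij (h.le_iff.2 ?_)
        split_ifs at h1 h2 <;> omega
      | onLeft e' he' i' =>
        have he2 := c.coords_of_mem_leftEdges h he'
        simp only [fst, snd] at h1 h2
        omega
      | onRight e' he' i' =>
        have he2 := c.coords_of_mem_rightEdges h he'
        simp only [fst, snd] at h1 h2
        omega
      | inner i' j' hij' =>
        simp only [fst, snd] at h1 h2
        exact inner_le_inner hij hij' (by omega) (by omega)

end IsGridCorner

end FourCell

/-! ### Staircase extensions of a grid -/

namespace FourCell

open MultiforkExtension

/-- The points of the grid with `k` additional rows and columns that lie on or below the staircase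
formed by the maximal new elements of the multifork extension. -/
def IsBelowStaircase (m n k p q : ℕ) : Prop :=
  -- Truncated subtraction makes the last condition vacuous outside `p ≥ m`, `q ≥ n`. There, with `p
  -- = m + (k - 1 - j)` and `q = n + i`, it says `i ≤ j`.
  p < m + k ∧ q < n + k ∧ (p + 1 - m) + (q + 1 - n) ≤ k + 1

/-- `P` arises from `L` by inserting `k` rows and columns into the grid and adding all points below
the staircase. -/
structure IsStaircaseExtension {L P : Type*} [PartialOrder P] (old : L → P) (f g : L → ℕ)
    (F G : P → ℕ) (m n k : ℕ) : Prop where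
  pos_fst : 0 < m
  pos_snd : 0 < n
  pos_mult : 0 < k
  le_iff : ∀ {a b : P}, a ≤ b ↔ F a ≤ F b ∧ G a ≤ G b
  fst_old : ∀ x, F (old x) = shift m k (f x)
  snd_old : ∀ x, G (old x) = shift n k (g x)
  exists_of_isBelowStaircase : ∀ p q, IsBelowStaircase m n k p q → ∃ a, F a = p ∧ G a = q
  isBelowStaircase_or_old : ∀ a, IsBelowStaircase m n k (F a) (G a) ∨ ∃ x, a = old x
  full : ∀ i ≤ m, ∀ j ≤ n, ∃ x, f x = i ∧ g x = j

namespace IsStaircaseExtension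

variable {L P : Type*} [PartialOrder P] {old : L → P} {f g : L → ℕ} {F G : P → ℕ}
  {M N m n k : ℕ}

theorem swap (s : IsStaircaseExtension old f g F G m n k) :
    IsStaircaseExtension old g f G F n m k where
  pos_fst := s.pos_snd
  pos_snd := s.pos_fst
  pos_mult := s.pos_mult
  le_iff := s.le_iff.trans and_comm
  fst_old := s.snd_old
  snd_old := s.fst_old
  exists_of_isBelowStaircase p q hpq := (s.exists_of_isBelowStaircase q p
    (by unfold IsBelowStaircase at *; omega)).imp fun _ => And.symm
  isBelowStaircase_or_old a := (s.isBelowStaircase_or_old a).imp_left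
    (by unfold IsBelowStaircase; omega)
  full i hi j hj := (s.full j hj i hi).imp fun _ => And.symm

theorem lt_iff (s : IsStaircaseExtension old f g F G m n k) {a b : P} :
    a < b ↔ F a ≤ F b ∧ G a ≤ G b ∧ (F a < F b ∨ G a < G b) := by
  rw [lt_iff_le_not_ge, s.le_iff, s.le_iff]
  omega

theorem old_le_old_iff [PartialOrder L] (s : IsStaircaseExtension old f g F G m n k)
    (h : IsGridCoordinates f g M N) {x y : L} : old x ≤ old y ↔ x ≤ y := by
  rw [s.le_iff, h.le_iff, s.fst_old, s.snd_old, s.fst_old, s.snd_old]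
  simp only [shift]
  split_ifs <;> omega

/-- If `a` is below the staircase, the next element is its right neighbour, or the point of column
`m + k` in its row, or the old point `(m, n)` when `a` is a maximal point of the staircase.
Otherwise everything above `a` is old and the covering comes from `L`. -/
theorem covBy_fst [PartialOrder L] (s : IsStaircaseExtension old f g F G m n k)
    (h : IsGridCoordinates f g M N) {a b : P} (h1 : F a < F b) (h2 : G a ≤ G b)
    (h3 : ∀ z, F a < F z → G a ≤ G z → b ≤ z) : a ⋖ b := by
  have hm := s.pos_fst
  have hn := s.pos_snd
  have hk := s.pos_mult
  refine ⟨s.lt_iff.2 (by omega), fun z haz hzb => ?_⟩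
  have haz' := s.lt_iff.1 haz
  have hzb' := s.lt_iff.1 hzb
  by_cases ha : IsBelowStaircase m n k (F a) (G a)
  · by_cases ha' : IsBelowStaircase m n k (F a + 1) (G a)
    · obtain ⟨c, hc, hc'⟩ := s.exists_of_isBelowStaircase _ _ ha'
      have hbc := s.le_iff.1 (h3 c (by omega) (by omega))
      omega
    · by_cases hq : G a < n
      · obtain ⟨x, hx, hx'⟩ := s.full m le_rfl (G a) hq.le
        have hcf := s.fst_old x
        have hcg := s.snd_old x
        rw [hx, shift, if_neg (lt_irrefl m)] at hcf
        rw [hx', shift, if_pos hq] at hcg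
        unfold IsBelowStaircase at ha ha'
        have hbc := s.le_iff.1 (h3 (old x) (by omega) (by omega))
        omega
      · obtain ⟨t, ht, ht'⟩ := s.full m le_rfl n le_rfl
        have hcf := s.fst_old t
        have hcg := s.snd_old t
        rw [ht, shift, if_neg (lt_irrefl m)] at hcf
        rw [ht', shift, if_neg (lt_irrefl n)] at hcg
        unfold IsBelowStaircase at ha ha'
        have hbc := s.le_iff.1 (h3 (old t) (by omega) (by omega))
        rcases s.isBelowStaircase_or_old z with hz | ⟨w, rfl⟩
        · unfold IsBelowStaircase at hz
          omega
        · rw [s.fst_old, s.snd_old] at haz' hzb'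
          simp only [shift] at haz' hzb'
          split_ifs at haz' hzb' <;> omega
  · obtain ⟨x, rfl⟩ := (s.isBelowStaircase_or_old a).resolve_left ha
    have hup : ∀ c, old x ≤ c → ∃ y, c = old y := fun c hc =>
      (s.isBelowStaircase_or_old c).resolve_left fun hc' => ha (by
        rw [s.le_iff] at hc
        unfold IsBelowStaircase at *
        omega)
    obtain ⟨w, rfl⟩ := hup z haz.le
    obtain ⟨y, rfl⟩ := hup b (haz.trans hzb).le
    have hcov : x ⋖ y := by
      rw [s.fst_old, s.fst_old] at h1
      rw [s.snd_old, s.snd_old] at h2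
      refine h.covBy_fst ?_ ?_ fun v hv hv' => (s.old_le_old_iff h).1 (h3 (old v) ?_ ?_)
      · simp only [shift] at h1
        split_ifs at h1 <;> omega
      · simp only [shift] at h2
        split_ifs at h2 <;> omega
      · rw [s.fst_old, s.fst_old]
        simp only [shift]
        split_ifs <;> omega
      · rw [s.snd_old, s.snd_old]
        simp only [shift]
        split_ifs <;> omega
    rw [lt_iff_le_not_ge, s.old_le_old_iff h, s.old_le_old_iff h, ← lt_iff_le_not_ge] at haz hzb
    exact hcov.2 haz hzb

theorem exists_fst [PartialOrder L] (s : IsStaircaseExtension old f g F G m n k)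
    (h : IsGridCoordinates f g M N) (i : ℕ) (hi : i ≤ M + k) : ∃ a, F a = i ∧ G a = 0 := by
  have hn := s.pos_snd
  rcases lt_or_ge i (m + k) with him | him
  · exact s.exists_of_isBelowStaircase i 0 (by unfold IsBelowStaircase; omega)
  · obtain ⟨x, hx, hx'⟩ := h.exists_fst (i - k) (by omega)
    refine ⟨old x, ?_, ?_⟩
    · rw [s.fst_old, hx, shift, if_neg (by omega)]
      omega
    · rw [s.snd_old, hx', shift, if_pos hn]

theorem le_fst [PartialOrder L] (s : IsStaircaseExtension old f g F G m n k)
    (h : IsGridCoordinates f g M N) (a : P) : F a ≤ M + k := by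
  rcases s.isBelowStaircase_or_old a with ha | ⟨x, rfl⟩
  · obtain ⟨t, ht, -⟩ := s.full m le_rfl 0 (Nat.zero_le _)
    have := h.le_fst t
    unfold IsBelowStaircase at ha
    omega
  · have := h.le_fst x
    rw [s.fst_old, shift]
    split_ifs <;> omega

theorem isGridCoordinates [PartialOrder L] (s : IsStaircaseExtension old f g F G m n k)
    (h : IsGridCoordinates f g M N) : IsGridCoordinates F G (M + k) (N + k) where
  pos_fst := Nat.add_pos_left h.pos_fst k
  pos_snd := Nat.add_pos_left h.pos_snd k
  le_iff := s.le_iff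
  exists_inf a b := by
    -- The region below the staircase is closed downwards, so it contains the meet as soon as it
    -- contains `a` or `b`. For two old points, `shift` commutes with `min`.
    by_cases ha : IsBelowStaircase m n k (F a) (G a)
    · exact s.exists_of_isBelowStaircase _ _ (by unfold IsBelowStaircase at *; omega)
    by_cases hb : IsBelowStaircase m n k (F b) (G b)
    · exact s.exists_of_isBelowStaircase _ _ (by unfold IsBelowStaircase at *; omega)
    obtain ⟨x, rfl⟩ := (s.isBelowStaircase_or_old a).resolve_left ha
    obtain ⟨y, rfl⟩ := (s.isBelowStaircase_or_old b).resolve_left hb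
    obtain ⟨z, hz, hz'⟩ := h.exists_inf x y
    refine ⟨old z, ?_, ?_⟩
    · simp only [s.fst_old, hz, shift]
      split_ifs <;> omega
    · simp only [s.snd_old, hz', shift]
      split_ifs <;> omega
  exists_top := by
    obtain ⟨t, ht, ht'⟩ := h.exists_top
    obtain ⟨x, hx, hx'⟩ := s.full m le_rfl n le_rfl
    have h1 := h.le_fst x
    have h2 := h.le_snd x
    refine ⟨old t, ?_, ?_⟩
    · rw [s.fst_old, shift, if_neg (by omega), ht]
    · rw [s.snd_old, shift, if_neg (by omega), ht']
  le_fst := s.le_fst h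
  le_snd := s.swap.le_fst h.swap
  exists_fst := s.exists_fst h
  exists_snd i hi := (s.swap.exists_fst h.swap i hi).imp fun _ => And.symm
  covBy_fst := s.covBy_fst h
  covBy_snd h1 h2 h3 := s.swap.covBy_fst h.swap h2 h1 fun z hz hz' => h3 z hz' hz

/-- Nothing changes above the top of the staircase. -/
theorem coheight_old [PartialOrder L] (s : IsStaircaseExtension old f g F G m n k)
    (h : IsGridCoordinates f g M N) {t : L} (ht : f t = m) :
    Order.coheight (old t) = Order.coheight t := by
  let φ : Set.Ici t ↪o Set.Ici (old t) :=
    OrderEmbedding.ofMapLEIff (fun x => ⟨old x.1, (s.old_le_old_iff h).2 x.2⟩)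
      fun x y => s.old_le_old_iff h
  -- Elements above `old t` have first coordinate at least `m + k`, so none is below the staircase
  -- and all are old.
  have hφ : Function.Surjective φ := by
    rintro ⟨a, ha⟩
    rcases s.isBelowStaircase_or_old a with ha' | ⟨x, rfl⟩
    · rw [Set.mem_Ici, s.le_iff, s.fst_old, ht, shift, if_neg (lt_irrefl m)] at ha
      unfold IsBelowStaircase at ha'
      omega
    · exact ⟨⟨x, (s.old_le_old_iff h).1 ha⟩, rfl⟩
  have hdim := Order.krullDim_eq_of_orderIso (RelIso.ofSurjective φ hφ)
  rw [← Order.coheight_eq_krullDim_Ici, ← Order.coheight_eq_krullDim_Ici] at hdim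
  exact (WithBot.coe_inj.1 hdim).symm

/-- Compare column `m` of `L` with column `m + k` of `P`: both have `n` points below the old point
`(m, n)`, above which nothing changes. Only the part along the lower edge grows, from `m` to `m + k`
steps. -/
theorem krullDim_eq_add [PartialOrder L] (s : IsStaircaseExtension old f g F G m n k)
    (h : IsGridCoordinates f g M N) : Order.krullDim P = Order.krullDim L + k := by
  obtain ⟨t, ht, ht'⟩ := s.full m le_rfl n le_rfl
  have hF := s.fst_old t
  have hG := s.snd_old t
  rw [ht, shift, if_neg (lt_irrefl m)] at hF
  rw [ht', shift, if_neg (lt_irrefl n)] at hG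
  rw [h.krullDim_eq s.pos_snd ht ht'.ge (fun j hj => s.full m le_rfl j hj.le)
    fun x hx hx' => h.le_iff.2 (by omega),
    (s.isGridCoordinates h).krullDim_eq (p := m + k) s.pos_snd hF (by omega) ?_ ?_,
    s.coheight_old h ht]
  · push_cast
    rw [add_assoc _ _ (k : WithBot ℕ∞)]
  · intro j hj
    obtain ⟨x, hx, hx'⟩ := s.full m le_rfl j hj.le
    exact ⟨old x, by rw [s.fst_old, hx, shift, if_neg (lt_irrefl m)],
      by rw [s.snd_old, hx', shift, if_pos hj]⟩
  · intro a ha ha'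
    rcases s.isBelowStaircase_or_old a with hst | ⟨x, rfl⟩
    · unfold IsBelowStaircase at hst
      omega
    · rw [s.snd_old, shift] at ha'
      rw [s.le_iff, hF, hG, s.snd_old, shift]
      split_ifs at ha' ⊢ <;> omega

end IsStaircaseExtension

variable {L : Type*} [Lattice L] {H : FourCell L} {f g : L → ℕ} {M N m n k : ℕ}

theorem IsGridCorner.isStaircaseExtension (c : H.IsGridCorner f g m n)
    (h : IsGridCoordinates f g M N) (hk : 0 < k) :
    IsStaircaseExtension (old : L → MultiforkExtension H k) f g (fst f) (snd g) m n k where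
  pos_fst := c.pos_fst
  pos_snd := c.pos_snd
  pos_mult := hk
  le_iff := c.multifork_le_iff h
  fst_old x := by rw [fst, c.fst_top]
  snd_old x := by rw [snd, c.snd_top]
  full := c.full
  exists_of_isBelowStaircase p q hpq := by
    have hm := c.pos_fst
    have hn := c.pos_snd
    have c1 := c.fst_top
    have c2 := c.snd_top
    obtain ⟨h1, h2, h3⟩ := hpq
    -- The four regions of the grid correspond to the four constructors: old points, right edges,
    -- left edges and the interior of `H`.
    rcases lt_or_ge p m with hp | hp <;> rcases lt_or_ge q n with hq | hq
    · obtain ⟨x, hx, hx'⟩ := c.full p hp.le q hq.le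
      exact ⟨old x, by rw [fst, hx, c1, shift, if_pos hp], by rw [snd, hx', c2, shift, if_pos hq]⟩
    · obtain ⟨x, hx, hx'⟩ := c.full p hp.le (n - 1) (by omega)
      obtain ⟨y, hy, hy'⟩ := c.full p hp.le n le_rfl
      refine ⟨onRight (x, y) (c.mem_rightEdges h (by dsimp only; omega) hy' (by dsimp only; omega)
        (by dsimp only; omega)) ⟨q - n, by omega⟩, hy, ?_⟩
      simp only [snd]
      omega
    · obtain ⟨x, hx, hx'⟩ := c.full (m - 1) (by omega) q hq.le
      obtain ⟨y, hy, hy'⟩ := c.full m le_rfl q hq.le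
      refine ⟨onLeft (x, y) (c.mem_leftEdges h (by dsimp only; omega) hy (by dsimp only; omega)
        (by dsimp only; omega)) ⟨k - 1 - (p - m), by omega⟩, ?_, hy'⟩
      simp only [fst]
      omega
    · refine ⟨inner ⟨q - n, by omega⟩ ⟨k - 1 - (p - m), by omega⟩ (Fin.mk_le_mk.2 (by omega)),
        ?_, ?_⟩
      · simp only [fst]
        omega
      · simp only [snd]
        omega
  isBelowStaircase_or_old a := by
    have c1 := c.fst_top
    have c2 := c.snd_top
    cases a with
    | old x => exact Or.inr ⟨x, rfl⟩
    | onLeft e he i =>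
      have he' := c.coords_of_mem_leftEdges h he
      left
      simp only [IsBelowStaircase, fst, snd]
      omega
    | onRight e he i =>
      have he' := c.coords_of_mem_rightEdges h he
      left
      simp only [IsBelowStaircase, fst, snd]
      omega
    | inner i j hij =>
      left
      simp only [IsBelowStaircase, fst, snd]
      omega

/-! ### Counting the elements -/

namespace MultiforkExtension

/-- The elements of the multifork extension, sorted by their constructors. -/
def equivSum : MultiforkExtension H k ≃
    L ⊕ (H.leftEdges × Fin k) ⊕ (H.rightEdges × Fin k) ⊕ {p : Fin k × Fin k // p.1 ≤ p.2} where
  toFun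
    | old x => .inl x
    | onLeft e he i => .inr (.inl (⟨e, he⟩, i))
    | onRight e he i => .inr (.inr (.inl (⟨e, he⟩, i)))
    | inner i j hij => .inr (.inr (.inr ⟨(i, j), hij⟩))
  invFun
    | .inl x => old x
    | .inr (.inl (e, i)) => onLeft e.1 e.2 i
    | .inr (.inr (.inl (e, i))) => onRight e.1 e.2 i
    | .inr (.inr (.inr p)) => inner p.1.1 p.1.2 p.2
  left_inv a := by cases a <;> rfl
  right_inv a := by rcases a with x | ⟨e, i⟩ | ⟨e, i⟩ | p <;> rfl

end MultiforkExtension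

/-- Sorted by the larger component `j`, there are `j + 1` choices for the smaller one. -/
theorem card_pairs_le (k : ℕ) :
    Nat.card {p : Fin k × Fin k // p.1 ≤ p.2} = k * (k + 1) / 2 := by
  have e : {p : Fin k × Fin k // p.1 ≤ p.2} ≃ (j : Fin k) × Fin (j + 1) :=
    { toFun := fun p => ⟨p.1.2, ⟨p.1.1, Nat.lt_succ_of_le p.2⟩⟩
      invFun := fun s => ⟨(⟨s.2, (Nat.le_of_lt_succ s.2.2).trans_lt s.1.2⟩, s.1),
        Fin.le_def.2 (Nat.le_of_lt_succ s.2.2)⟩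
      left_inv := fun _ => rfl
      right_inv := fun _ => rfl }
  rw [Nat.card_congr e, Nat.card_eq_fintype_card, Fintype.card_sigma]
  simp only [Fintype.card_fin]
  rw [Fin.sum_univ_eq_sum_range fun j => j + 1, Finset.sum_add_distrib, Finset.sum_const,
    Finset.card_range, smul_eq_mul, mul_one, Finset.sum_range_id]
  rcases k with _ | k
  · rfl
  · have h1 : (k + 1) * (k + 1 + 1) = (k + 1) * k + (k + 1) * 2 := by ring
    rw [h1, Nat.add_mul_div_right _ _ two_pos, Nat.add_sub_cancel]

/-- There are `n` left and `m` right edges, each with `k` new elements, and `m + n` is the height of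
`H.top`. -/
theorem IsGridCorner.card_multifork (c : H.IsGridCorner f g m n) (h : IsGridCoordinates f g M N) :
    ENat.card (H.MultiforkExtension k) =
      ENat.card L + k * Order.height H.top + ((k * (k + 1) / 2 : ℕ) : ℕ∞) := by
  have := h.finite
  have hheight := h.height_eq (t := H.top)
    (by rw [c.fst_top, c.snd_top]; exact c.full)
  have : Finite H.leftEdges := Subtype.finite
  have : Finite H.rightEdges := Subtype.finite
  have : Finite (H.MultiforkExtension k) := Finite.of_equiv _ equivSum.symm
  rw [hheight, c.fst_top, c.snd_top, ENat.card_eq_coe_natCard, ENat.card_eq_coe_natCard,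
    Nat.card_congr equivSum, Nat.card_sum, Nat.card_sum, Nat.card_sum, Nat.card_prod,
    Nat.card_prod, card_pairs_le, c.card_leftEdges h, c.card_rightEdges h, Nat.card_fin]
  norm_cast
  ring

end FourCell

theorem lemma2p4 {L : Type*} [Lattice L] (hL : IsSlimRectangular L) (H : FourCell L)
    (hH : H.IsDistributive) (k : ℕ) (hk : 0 < k) :
    (∃ inst : Lattice (H.MultiforkExtension k),
      inst.toSemilatticeSup.toPartialOrder =
          (inferInstance : PartialOrder (H.MultiforkExtension k)) ∧
        @IsSlimRectangular (H.MultiforkExtension k) inst) ∧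
    ENat.card (H.MultiforkExtension k) =
      ENat.card L + k * Order.height H.top + ((k * (k + 1) / 2 : ℕ) : ℕ∞) ∧
    Order.krullDim (H.MultiforkExtension k) = Order.krullDim L + k := by
  obtain ⟨f, g, M, N, m, n, h, c⟩ := FourCell.exists_isGridCorner hL hH
  have s := c.isStaircaseExtension h hk
  exact ⟨(s.isGridCoordinates h).exists_lattice_isSlimRectangular, c.card_multifork h,
    s.krullDim_eq_add h⟩
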